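/- Let $a,b>0$ and let $\xi\in(0,1)$ be irrational. For $\alpha\ge 0$ let $\mathcal A_\alpha$ be the unbounded operator on $\mathcal H=[H^2(0,1)\cap H^1_0(0,1)]\times L^2(0,1)$ given by $$\mathcal A_\alpha(u,v)=\big(v,\,-a\,u''''-b\,v-\alpha v(\xi)\delta_\xi\big),$$ whose domain is the set of $(u,v)$ with $u\in H^4(0,\xi)\cap H^4(\xi,1)\cap H^2(0,1)$, $v\in H^2(0,1)$, $u(0)=u(1)=v(0)=v(1)=u''(0)=u''(1)=0$, $u''(\xi^-)=u''(\xi^+)$ and $u'''(\xi^+)-u'''(\xi^-)=-\frac{\alpha}{a}v(\xi)$. (The Dirac mass in the formula cancels the one in the distributional derivative $u''''$ on $(0,1)$.) For $n\ge 1$ put $$\mu_n^\pm=\tfrac12\big(-b\pm\sqrt{b^2-4an^4\pi^4}\big)\ \text{ if } 4an^4\pi^4\le b^2,\qquad \mu_n^\pm=\tfrac12\big(-b\pm i\sqrt{4an^4\pi^4-b^2}\big)\ \text{ otherwise},$$ and $\Phi_n^\pm(x)=\sin(n\pi x)\,(1,\mu_n^\pm)$. For $\mu\in\mathbb C$ and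 a nonzero fourth root $\lambda$ of $-(b\mu+\mu^2)/a$ put $\Phi(\mu,x)=\phi(\lambda,x)(1,\mu)$, where $$\phi(\lambda,x)=\frac{e^{(\xi-2)|\lambda|}}{|\lambda|^2}\Big\{\sin\lambda\,\sinh\lambda\,\big[\sinh(\lambda(x-\xi))-\sin(\lambda(x-\xi))\big]H(x,\xi)+\sinh\lambda\,\sin(\lambda(1-\xi))\sin(\lambda x)-\sin\lambda\,\sinh(\lambda(1-\xi))\sinh(\lambda x)\Big\}$$ and $H(x,\xi)=1$ if $x\ge\xi$, $H(x,\xi)=0$ if $x<\xi$. 1. (Continuity of the eigenvalues.) There are continuous functions $m_j:[0,6/b)\to\mathbb C$, $j\in\mathbb N$, such that for every $\alpha\in[0,6/b)$ the set of eigenvalues of $\mathcal A_\alpha$ is exactly $\{m_j(\alpha): j\in\mathbb N\}$ (repetitions being allowed), and such that for every $R$ only finitely many indices $j$ satisfy $|m_j(\alpha)|\le R$ for some $\alpha\in[0,6/b)$. In particular every eigenvalue of every $\mathcal A_\alpha$, $\alpha>0$, $\alpha b<6$, can be followed continuously in $\alpha$ over the whole interval. 2. (Convergence of the eigenvectors.)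 Let $0<\alpha_1\le 6/b$, let $\mu:(0,\alpha_1)\to\mathbb C$ be continuous with $\mu(\alpha)$ an eigenvalue of $\mathcal A_\alpha$ for every $\alpha$, and let $\lambda(\alpha)$ be the fourth root of $-(b\mu(\alpha)+\mu(\alpha)^2)/a$ with argument in $[-\pi/4,\pi/4)$. Then there are $n\ge 1$ and a sign $\pm$ such that $\Phi_n^\pm$ is an eigenvector of $\mathcal A_0$ for the eigenvalue $\mu_n^\pm$ and $\mu(\alpha)\to\mu_n^\pm$ as $\alpha\to0^+$. Moreover, for each $\zeta\in\{1,-1,i,-i\}$, with $\Phi(\mu(\alpha),\cdot)$ formed with the fourth root $\zeta\lambda(\alpha)$: for all sufficiently small $\alpha>0$ the function $\Phi(\mu(\alpha),\cdot)$ is an eigenvector of $\mathcal A_\alpha$ for the eigenvalue $\mu(\alpha)$, and there is a constant $c\ne0$ such that $\Phi(\mu(\alpha),x)\to c\,\Phi_n^\pm(x)$ as $\alpha\to0^+$ for every $x\in(0,1)$. -/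

import Mathlib

open Set Filter Topology MeasureTheory

noncomputable section

namespace Beam

/-- The complex Hilbert space `L²(0,1)`. -/
abbrev L2 : Type := Lp ℂ 2 (volume.restrict (Ioo (0 : ℝ) 1))

/-- `p 0` is (the continuous representative of) a function in the Sobolev space `H^k(c,d)`, and
`p 1, …, p k` are its successive weak derivatives: for `i < k` the function `p i` is absolutely
continuous on `[c,d]` with derivative `p (i+1)`, and the last derivative `p k` is square
integrable. So for `i < k` the value `p i x` is the trace of the `i`-th derivative, at
the end points `c`, `d` as well. -/
def IsSobolev (k : ℕ) (c d : ℝ) (p : ℕ → ℝ → ℂ) : Prop :=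
  (∀ i < k, IntervalIntegrable (p (i + 1)) volume c d ∧
    ∀ x ∈ Icc c d, p i x = p i c + ∫ t in c..x, p (i + 1) t) ∧
  MemLp (p k) 2 (volume.restrict (Ioo c d))

theorem IsSobolev.zero (k : ℕ) (c d : ℝ) : IsSobolev k c d 0 := by
  refine ⟨fun i _ => ⟨?_, fun x _ => ?_⟩, ?_⟩
  · exact IntervalIntegrable.zero
  · simp
  · exact MemLp.zero

theorem IsSobolev.add {k : ℕ} {c d : ℝ} {p q : ℕ → ℝ → ℂ}
    (hp : IsSobolev k c d p) (hq : IsSobolev k c d q) : IsSobolev k c d (p + q) := by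
  refine ⟨fun i hi => ⟨?_, fun x hx => ?_⟩, hp.2.add hq.2⟩
  · exact (hp.1 i hi).1.add (hq.1 i hi).1
  · have hsub : uIcc c x ⊆ uIcc c d := by
      rw [uIcc_of_le hx.1, uIcc_of_le (hx.1.trans hx.2)]
      exact Icc_subset_Icc_right hx.2
    have h := intervalIntegral.integral_add ((hp.1 i hi).1.mono_set hsub)
      ((hq.1 i hi).1.mono_set hsub)
    simp only [Pi.add_apply]
    rw [h, (hp.1 i hi).2 x hx, (hq.1 i hi).2 x hx]
    ring

theorem IsSobolev.smul {k : ℕ} {c d : ℝ} {p : ℕ → ℝ → ℂ} (z : ℂ)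
    (hp : IsSobolev k c d p) : IsSobolev k c d (z • p) := by
  refine ⟨fun i hi => ⟨?_, fun x hx => ?_⟩, hp.2.const_smul z⟩
  · exact (hp.1 i hi).1.smul z
  · simp only [Pi.smul_apply]
    rw [intervalIntegral.integral_smul, (hp.1 i hi).2 x hx, smul_add]

/-- The space `H²(0,1) ∩ H¹₀(0,1)`, as a subspace of `L²(0,1)`. -/
def V : Submodule ℂ L2 where
  carrier := {f | ∃ p : ℕ → ℝ → ℂ, IsSobolev 2 0 1 p ∧ p 0 0 = 0 ∧ p 0 1 = 0 ∧
    (f : ℝ → ℂ) =ᵐ[volume.restrict (Ioo 0 1)] p 0}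
  zero_mem' := ⟨0, IsSobolev.zero _ _ _, rfl, rfl, Lp.coeFn_zero _ _ _⟩
  add_mem' := by
    rintro f g ⟨p, hp, hp0, hp1, hfp⟩ ⟨q, hq, hq0, hq1, hgq⟩
    refine ⟨p + q, hp.add hq, by simp [hp0, hq0], by simp [hp1, hq1], ?_⟩
    filter_upwards [Lp.coeFn_add f g, hfp, hgq] with x h1 h2 h3
    rw [h1, Pi.add_apply, h2, h3]; rfl
  smul_mem' := by
    rintro z f ⟨p, hp, hp0, hp1, hfp⟩
    refine ⟨z • p, hp.smul z, by simp [hp0], by simp [hp1], ?_⟩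
    filter_upwards [Lp.coeFn_smul z f, hfp] with x h1 h2
    rw [h1, Pi.smul_apply, h2]; rfl

/-- The energy space `[H²(0,1) ∩ H¹₀(0,1)] × L²(0,1)` (as a complex vector space). -/
abbrev Energy : Type := V × L2

/-- `InGraph a b α ξ U F` says that `U = (u,v)` belongs to the domain of the beam operator and that
its image is `F`. Here `l`, `r` are `u` with its derivatives on `(0,ξ)` and on `(ξ,1)`, and `q` is
`v` with its derivatives on `(0,1)`. The conditions are
`u ∈ H⁴(0,ξ) ∩ H⁴(ξ,1) ∩ H²(0,1)`, `v ∈ H²(0,1)`, `u(0) = u(1) = v(0) = v(1) = 0`,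
`u''(0) = u''(1) = 0`, `u''(ξ⁻) = u''(ξ⁺)`, `u'''(ξ⁺) - u'''(ξ⁻) = -(α/a) v(ξ)`, and
`F = (v, -a u'''' - b v - α v(ξ) δ_ξ)`; the fourth derivative in the sense of distributions on
`(0,1)` has at `ξ` the mass `u'''(ξ⁺) - u'''(ξ⁻)`, which cancels the Dirac mass, so that the second
component is `-a u'''' - b v` with the fourth derivative taken on `(0,ξ)` and on `(ξ,1)`. -/
def InGraph (a b α ξ : ℝ) (U F : Energy) : Prop :=
  (F.1 : L2) = U.2 ∧
  ∃ l r q : ℕ → ℝ → ℂ,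
    IsSobolev 4 0 ξ l ∧ IsSobolev 4 ξ 1 r ∧ IsSobolev 2 0 1 q ∧
    ((U.1 : L2) : ℝ → ℂ) =ᵐ[volume.restrict (Ioo 0 ξ)] l 0 ∧
    ((U.1 : L2) : ℝ → ℂ) =ᵐ[volume.restrict (Ioo ξ 1)] r 0 ∧
    (U.2 : ℝ → ℂ) =ᵐ[volume.restrict (Ioo 0 1)] q 0 ∧
    l 2 0 = 0 ∧ r 2 1 = 0 ∧ l 2 ξ = r 2 ξ ∧
    r 3 ξ - l 3 ξ = -((α / a : ℝ) : ℂ) * q 0 ξ ∧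
    (F.2 : ℝ → ℂ) =ᵐ[volume.restrict (Ioo 0 ξ)] (fun x => -(a : ℂ) * l 4 x - (b : ℂ) * U.2 x) ∧
    (F.2 : ℝ → ℂ) =ᵐ[volume.restrict (Ioo ξ 1)] (fun x => -(a : ℂ) * r 4 x - (b : ℂ) * U.2 x)

theorem ae_restrict_of_Ioo {P : ℝ → Prop} {c d : ℝ} (h0 : 0 ≤ c) (h1 : d ≤ 1)
    (h : ∀ᵐ x ∂(volume.restrict (Ioo (0 : ℝ) 1)), P x) :
    ∀ᵐ x ∂(volume.restrict (Ioo c d)), P x :=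
  ae_restrict_of_ae_restrict_of_subset (Ioo_subset_Ioo h0 h1) h

/-- The graph of the beam operator is a linear subspace. -/
def graph (a b α : ℝ) (ξ : Ioo (0 : ℝ) 1) : Submodule ℂ (Energy × Energy) where
  carrier := {W | InGraph a b α ξ W.1 W.2}
  zero_mem' := by
    have h0 : ((0 : L2) : ℝ → ℂ) =ᵐ[volume.restrict (Ioo (0 : ℝ) 1)] 0 := Lp.coeFn_zero _ _ _
    have hl := ae_restrict_of_Ioo (c := 0) (d := ξ) le_rfl ξ.2.2.le h0
    have hr := ae_restrict_of_Ioo (c := ξ) (d := 1) ξ.2.1.le le_rfl h0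
    refine ⟨rfl, 0, 0, 0, IsSobolev.zero _ _ _, IsSobolev.zero _ _ _, IsSobolev.zero _ _ _,
      hl, hr, h0, rfl, rfl, rfl, by simp, ?_, ?_⟩
    · filter_upwards [hl] with x hx
      refine hx.trans ?_
      have h5 : ((0 : Energy × Energy).1.2 : ℝ → ℂ) x = 0 := hx
      simp only [h5, Pi.zero_apply, mul_zero, sub_zero]
    · filter_upwards [hr] with x hx
      refine hx.trans ?_
      have h5 : ((0 : Energy × Energy).1.2 : ℝ → ℂ) x = 0 := hx
      simp only [h5, Pi.zero_apply, mul_zero, sub_zero]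
  add_mem' := by
    rintro ⟨U, F⟩ ⟨U', F'⟩ ⟨hv, l, r, q, hl, hr, hq, ul, ur, vq, l0, r1, e2, e3, gl, gr⟩
      ⟨hv', l', r', q', hl', hr', hq', ul', ur', vq', l0', r1', e2', e3', gl', gr'⟩
    have hU1 := Lp.coeFn_add (U.1 : L2) (U'.1 : L2)
    have hU2 := Lp.coeFn_add U.2 U'.2
    have hF2 := Lp.coeFn_add F.2 F'.2
    refine ⟨?_, l + l', r + r', q + q', hl.add hl', hr.add hr', hq.add hq', ?_, ?_, ?_,
      by simp [l0, l0'], by simp [r1, r1'], by simp [e2, e2'], ?_, ?_, ?_⟩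
    · simp only at hv hv'
      simp [hv, hv']
    · filter_upwards [ae_restrict_of_Ioo (c := 0) (d := ξ) le_rfl ξ.2.2.le hU1, ul, ul']
        with x h1 h2 h3
      exact h1.trans (congrArg₂ (· + ·) h2 h3)
    · filter_upwards [ae_restrict_of_Ioo (c := ξ) (d := 1) ξ.2.1.le le_rfl hU1, ur, ur']
        with x h1 h2 h3
      exact h1.trans (congrArg₂ (· + ·) h2 h3)
    · filter_upwards [hU2, vq, vq'] with x h1 h2 h3
      exact h1.trans (congrArg₂ (· + ·) h2 h3)
    · simp only [Pi.add_apply]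
      linear_combination e3 + e3'
    · filter_upwards [ae_restrict_of_Ioo (c := 0) (d := ξ) le_rfl ξ.2.2.le hU2,
        ae_restrict_of_Ioo (c := 0) (d := ξ) le_rfl ξ.2.2.le hF2, gl, gl'] with x h1 h2 h3 h4
      refine h2.trans ?_
      have h5 : (((U, F) + (U', F')).1.2 : ℝ → ℂ) x = U.2 x + U'.2 x := h1
      simp only [Pi.add_apply] at h3 h4 ⊢
      rw [h5, h3, h4]; ring
    · filter_upwards [ae_restrict_of_Ioo (c := ξ) (d := 1) ξ.2.1.le le_rfl hU2,
        ae_restrict_of_Ioo (c := ξ) (d := 1) ξ.2.1.le le_rfl hF2, gr, gr'] with x h1 h2 h3 h4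
      refine h2.trans ?_
      have h5 : (((U, F) + (U', F')).1.2 : ℝ → ℂ) x = U.2 x + U'.2 x := h1
      simp only [Pi.add_apply] at h3 h4 ⊢
      rw [h5, h3, h4]; ring
  smul_mem' := by
    rintro z ⟨U, F⟩ ⟨hv, l, r, q, hl, hr, hq, ul, ur, vq, l0, r1, e2, e3, gl, gr⟩
    have hU1 := Lp.coeFn_smul z (U.1 : L2)
    have hU2 := Lp.coeFn_smul z U.2
    have hF2 := Lp.coeFn_smul z F.2
    refine ⟨?_, z • l, z • r, z • q, hl.smul z, hr.smul z, hq.smul z, ?_, ?_, ?_,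
      by simp [l0], by simp [r1], by simp [e2], ?_, ?_, ?_⟩
    · simp only at hv
      simp [hv]
    · filter_upwards [ae_restrict_of_Ioo (c := 0) (d := ξ) le_rfl ξ.2.2.le hU1, ul] with x h1 h2
      exact h1.trans (congrArg (z • ·) h2)
    · filter_upwards [ae_restrict_of_Ioo (c := ξ) (d := 1) ξ.2.1.le le_rfl hU1, ur] with x h1 h2
      exact h1.trans (congrArg (z • ·) h2)
    · filter_upwards [hU2, vq] with x h1 h2
      exact h1.trans (congrArg (z • ·) h2)
    · simp only [Pi.smul_apply, smul_eq_mul]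
      linear_combination z * e3
    · filter_upwards [ae_restrict_of_Ioo (c := 0) (d := ξ) le_rfl ξ.2.2.le hU2,
        ae_restrict_of_Ioo (c := 0) (d := ξ) le_rfl ξ.2.2.le hF2, gl] with x h1 h2 h3
      refine h2.trans ?_
      have h5 : ((z • (U, F)).1.2 : ℝ → ℂ) x = z * U.2 x := h1
      simp only [Pi.smul_apply, smul_eq_mul] at h3 ⊢
      rw [h5, h3]; ring
    · filter_upwards [ae_restrict_of_Ioo (c := ξ) (d := 1) ξ.2.1.le le_rfl hU2,
        ae_restrict_of_Ioo (c := ξ) (d := 1) ξ.2.1.le le_rfl hF2, gr] with x h1 h2 h3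
      refine h2.trans ?_
      have h5 : ((z • (U, F)).1.2 : ℝ → ℂ) x = z * U.2 x := h1
      simp only [Pi.smul_apply, smul_eq_mul] at h3 ⊢
      rw [h5, h3]; ring

theorem IsSobolev.ae_zero_succ {k : ℕ} {c d : ℝ} {p : ℕ → ℝ → ℂ}
    (hp : IsSobolev k c d p) {i : ℕ} (hi : i < k)
    (h : p i =ᵐ[volume.restrict (Ioo c d)] 0) : p (i + 1) =ᵐ[volume.restrict (Ioo c d)] 0 := by
  rcases le_or_gt d c with hdc | hcd
  · rw [Ioo_eq_empty hdc.not_gt, Measure.restrict_empty, Filter.EventuallyEq, ae_zero]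
    exact Filter.eventually_bot
  obtain ⟨hint, heq⟩ := hp.1 i hi
  have hcont : ContinuousOn (p i) (Ioo c d) := by
    have h1 : ContinuousOn (fun x => ∫ t in c..x, p (i + 1) t) (uIcc c d) :=
      intervalIntegral.continuousOn_primitive_interval' hint left_mem_uIcc
    rw [uIcc_of_le hcd.le] at h1
    refine ((continuousOn_const (c := p i c)).add (h1.mono Ioo_subset_Icc_self)).congr ?_
    intro x hx
    exact heq x (Ioo_subset_Icc_self hx)
  have hzero : EqOn (p i) 0 (Ioo c d) :=
    Measure.eqOn_Ioo_of_ae_eq volume h hcont continuousOn_const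
  rw [Filter.EventuallyEq, ae_restrict_iff' measurableSet_Ioo]
  filter_upwards [hint.ae_hasDerivAt_integral] with x hx hxI
  have hxc : x ∈ uIcc c d := by
    rw [uIcc_of_le hcd.le]; exact Ioo_subset_Icc_self hxI
  have hd := hx hxc c left_mem_uIcc
  have hd' : HasDerivAt (fun _ : ℝ => -p i c) (0 : ℂ) x := hasDerivAt_const _ _
  refine hd.unique (hd'.congr_of_eventuallyEq ?_)
  filter_upwards [Ioo_mem_nhds hxI.1 hxI.2] with y hy
  have h1 := heq y (Ioo_subset_Icc_self hy)
  rw [hzero hy] at h1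
  simp only [Pi.zero_apply] at h1
  linear_combination -h1

theorem graph_singleValued (a b α : ℝ) (ξ : Ioo (0 : ℝ) 1) :
    ∀ W ∈ graph a b α ξ, W.1 = 0 → W.2 = 0 := by
  rintro ⟨U, F⟩ ⟨hv, l, r, q, hl, hr, hq, ul, ur, vq, l0, r1, e2, e3, gl, gr⟩ h
  obtain rfl : U = 0 := h
  have h0 : ((0 : L2) : ℝ → ℂ) =ᵐ[volume.restrict (Ioo (0 : ℝ) 1)] 0 := Lp.coeFn_zero _ _ _
  have h0l := ae_restrict_of_Ioo (c := 0) (d := ξ) le_rfl ξ.2.2.le h0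
  have h0r := ae_restrict_of_Ioo (c := ξ) (d := 1) ξ.2.1.le le_rfl h0
  have hl0 : l 0 =ᵐ[volume.restrict (Ioo (0 : ℝ) ξ)] 0 := ul.symm.trans h0l
  have hr0 : r 0 =ᵐ[volume.restrict (Ioo (ξ : ℝ) 1)] 0 := ur.symm.trans h0r
  have hl4 := hl.ae_zero_succ (i := 3) (by norm_num) (hl.ae_zero_succ (i := 2) (by norm_num)
    (hl.ae_zero_succ (i := 1) (by norm_num) (hl.ae_zero_succ (i := 0) (by norm_num) hl0)))
  have hr4 := hr.ae_zero_succ (i := 3) (by norm_num) (hr.ae_zero_succ (i := 2) (by norm_num)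
    (hr.ae_zero_succ (i := 1) (by norm_num) (hr.ae_zero_succ (i := 0) (by norm_num) hr0)))
  have hFl : ∀ᵐ x ∂(volume.restrict (Ioo (0 : ℝ) ξ)), (F.2 : ℝ → ℂ) x = 0 := by
    filter_upwards [gl, hl4, h0l] with x h1 h2 h3
    have h5 : ((0 : Energy).2 : ℝ → ℂ) x = 0 := h3
    have h6 : l 4 x = 0 := h2
    simp only [h5, h6] at h1
    simpa using h1
  have hFr : ∀ᵐ x ∂(volume.restrict (Ioo (ξ : ℝ) 1)), (F.2 : ℝ → ℂ) x = 0 := by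
    filter_upwards [gr, hr4, h0r] with x h1 h2 h3
    have h5 : ((0 : Energy).2 : ℝ → ℂ) x = 0 := h3
    have h6 : r 4 x = 0 := h2
    simp only [h5, h6] at h1
    simpa using h1
  have hF2 : F.2 = 0 := by
    refine Lp.ext (Filter.EventuallyEq.trans ?_ h0.symm)
    rw [ae_restrict_iff' measurableSet_Ioo] at hFl hFr
    rw [Filter.EventuallyEq, ae_restrict_iff' measurableSet_Ioo]
    filter_upwards [hFl, hFr, (by simp [ae_iff] : ∀ᵐ x : ℝ, x ≠ ξ)] with x h1 h2 h3 hx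
    rcases lt_or_gt_of_ne h3 with h | h
    · exact h1 ⟨hx.1, h⟩
    · exact h2 ⟨h, hx.2⟩
  exact Prod.ext (Subtype.ext hv) hF2

/-- The beam operator `A(u,v) = (v, -a u'''' - b v - α v(ξ) δ_ξ)`, an unbounded linear operator of
the energy space. -/
def A (a b α : ℝ) (ξ : Ioo (0 : ℝ) 1) : Energy →ₗ.[ℂ] Energy :=
  (graph a b α ξ).toLinearPMap

/-- The domain and the values of `A` are those described by `InGraph`. -/
theorem mem_graph_A_iff (a b α : ℝ) (ξ : Ioo (0 : ℝ) 1) (U F : Energy) :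
    (U, F) ∈ (A a b α ξ).graph ↔ InGraph a b α ξ U F := by
  rw [A, Submodule.toLinearPMap_graph_eq _ (graph_singleValued a b α ξ)]
  rfl

/-- `U` is an eigenvector of the unbounded operator `T` for the eigenvalue `μ`. -/
def IsEigenvector (T : Energy →ₗ.[ℂ] Energy) (μ : ℂ) (U : T.domain) : Prop :=
  U ≠ 0 ∧ T U = μ • (U : Energy)

/-- `μ` is an eigenvalue of the unbounded operator `T`. -/
def IsEigenvalue (T : Energy →ₗ.[ℂ] Energy) (μ : ℂ) : Prop :=
  ∃ U : T.domain, IsEigenvector T μ U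

/-- The pair of functions `f = (f₁,f₂)` on `(0,1)` is (a representative of) an eigenvector of `T`
for the eigenvalue `μ`. -/
def IsEigenfunction (T : Energy →ₗ.[ℂ] Energy) (μ : ℂ) (f : ℝ → ℂ × ℂ) : Prop :=
  ∃ U : T.domain, IsEigenvector T μ U ∧
    (((U : Energy).1 : L2) : ℝ → ℂ) =ᵐ[volume.restrict (Ioo 0 1)] (fun x => (f x).1) ∧
    ((U : Energy).2 : ℝ → ℂ) =ᵐ[volume.restrict (Ioo 0 1)] (fun x => (f x).2)

/-- `lam` is the fourth root of `-(bμ + μ²)/a` with argument in `[-π/4, π/4)`. The other fourth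
roots are `-lam` and `± i lam`. -/
def IsPrincipalRoot (a b : ℝ) (μ lam : ℂ) : Prop :=
  lam ^ 4 = -((b : ℂ) * μ + μ ^ 2) / (a : ℂ) ∧ lam.arg ∈ Ico (-(Real.pi / 4)) (Real.pi / 4)

/-- The scalar profile `φ(λ, ·)` of the eigenvectors. -/
def phi (ξ : ℝ) (lam : ℂ) (x : ℝ) : ℂ :=
  ((1 / ‖lam‖ ^ 2 * Real.exp ((ξ - 2) * ‖lam‖) : ℝ) : ℂ) *
    (Complex.sin lam * Complex.sinh lam *
        (Complex.sinh (lam * (x - ξ)) - Complex.sin (lam * (x - ξ))) * (if ξ ≤ x then 1 else 0) +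
      Complex.sinh lam * Complex.sin (lam * (1 - ξ)) * Complex.sin (lam * x) -
      Complex.sin lam * Complex.sinh (lam * (1 - ξ)) * Complex.sinh (lam * x))

/-- The eigenvector `Φ(μ, ·) = φ(λ, ·) (1, μ)`, where `λ` is a fourth root of `-(bμ + μ²)/a`. -/
def Phi (ξ : ℝ) (lam μ : ℂ) (x : ℝ) : ℂ × ℂ :=
  (phi ξ lam x, μ * phi ξ lam x)

/-- The eigenvalues `μ_n^±` for `α = 0`; `s = 1` and `s = -1` stand for the two signs. -/
def muZero (a b : ℝ) (n : ℕ) (s : ℤˣ) : ℂ :=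
  if 4 * a * n ^ 4 * Real.pi ^ 4 ≤ b ^ 2 then
    (1 / 2) * (-(b : ℂ) + ((s : ℤ) : ℂ) * (Real.sqrt (b ^ 2 - 4 * a * n ^ 4 * Real.pi ^ 4) : ℂ))
  else
    (1 / 2) * (-(b : ℂ) + ((s : ℤ) : ℂ) *
      (Complex.I * (Real.sqrt (4 * a * n ^ 4 * Real.pi ^ 4 - b ^ 2) : ℂ)))

/-- The eigenvectors `Φ_n^± = sin(nπx) (1, μ_n^±)` for `α = 0`. -/
def PhiZero (a b : ℝ) (n : ℕ) (s : ℤˣ) (x : ℝ) : ℂ × ℂ :=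
  (Complex.sin (n * Real.pi * x), muZero a b n s * Complex.sin (n * Real.pi * x))

end Beam

end

noncomputable section

namespace Beam

/-! ### Power series solutions of u'''' = w u -/

open scoped Nat

/-! The eigenvalue problem reduces to a scalar equation. With w = -(bμ + μ²)/a, an eigenvector
solves u'''' = w u on both sides of ξ. The conditions at 0 leave two coefficients A, B, and the load
adds a third, the jump C of u''' at ξ. The two conditions at 1 and the jump law form a 3 × 3 linear
system whose determinant is S(w) + (α/a) μ T(w) (`exists_loadEq_iff`, `isEigenvalue_iff`). Power
series in w instead of sines of λ = w^(1/4) make this an entire function f(μ) + α g(μ), with no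
choice of root and no degeneracy at λ = 0.

Irrationality of ξ ensures that f and g have no common zero (`charG_ne_zero`). So near a zero at α₀
the equation reads h(z) = α - α₀ with h analytic. Writing h = ψ^k for a local coordinate ψ, and
taking a continuous k-th root of the real variable α - α₀, one gets all nearby zeros as finitely
many continuous functions, at multiple zeros too (`exists_local_hasBranches`). Compactness and
gluing in α extend this to a whole interval, provided that zeros cannot leave the region
(`hasBranches_Icc`). Confinement comes from the circles |w| = ((n + 1/2)π)⁴: on them λ³ sin λ sinh λ
dominates the load term for large n, uniformly for bounded α (`char_ne_zero_of_norm`). Each annulus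
between consecutive circles then carries finitely many branches, and all of them together form the
required sequence (`exists_branches`).

Along a branch with α → 0⁺ the same circles keep μ(α) bounded, so f(μ(α)) = -α g(μ(α)) → 0. Since
the zeros of f are isolated and the branch is connected, it converges to one of them, some μ_n^±
(`exists_tendsto_muZero`). The principal root then tends to nπ, where sin λ = 0 leaves only the
sin(λx) term of φ, with the factor sinh(nπ) sin(nπ(1 - ξ)), nonzero again by irrationality
(`tendsto_Phi`). -/

/-- The fundamental solutions `∑ j, w ^ j * x ^ (4 * j + k) / (4 * j + k)!` of `u'''' = w u`. -/
def kry (k : ℕ) (w x : ℂ) : ℂ := ∑' j : ℕ, w ^ j * x ^ (4 * j + k) / ((4 * j + k)! : ℂ)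

/-- A Weierstrass bound uniform on bounded sets of w and of x at once, so that the sum is entire in
each variable and can be differentiated term by term. It is crude: (4j + k)! is replaced by j!. -/
theorem norm_kry_term_le {k : ℕ} {w x : ℂ} {W X : ℝ} (hw : ‖w‖ ≤ W) (hx : ‖x‖ ≤ X) (j : ℕ) :
    ‖w ^ j * x ^ (4 * j + k) / ((4 * j + k)! : ℂ)‖ ≤ X ^ k * ((W * X ^ 4) ^ j / j !) := by
  have hW : 0 ≤ W := (norm_nonneg _).trans hw
  have hX : 0 ≤ X := (norm_nonneg _).trans hx
  have hf : (j ! : ℝ) ≤ ((4 * j + k)! : ℝ) := by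
    exact_mod_cast Nat.factorial_le (by omega)
  have hj : (0 : ℝ) < j ! := by exact_mod_cast Nat.factorial_pos j
  rw [norm_div, norm_mul, norm_pow, norm_pow, Complex.norm_natCast]
  calc ‖w‖ ^ j * ‖x‖ ^ (4 * j + k) / ((4 * j + k)! : ℝ)
      ≤ W ^ j * X ^ (4 * j + k) / (j ! : ℝ) := by gcongr
    _ = _ := by rw [mul_pow, ← pow_mul, pow_add]; ring

theorem summable_kry_bound (k : ℕ) (W X : ℝ) :
    Summable fun j : ℕ => X ^ k * ((W * X ^ 4) ^ j / j !) :=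
  (Real.summable_pow_div_factorial _).mul_left _

theorem hasSum_kry (k : ℕ) (w x : ℂ) :
    HasSum (fun j : ℕ => w ^ j * x ^ (4 * j + k) / ((4 * j + k)! : ℂ)) (kry k w x) :=
  (Summable.of_norm_bounded (summable_kry_bound k ‖w‖ ‖x‖)
    (fun j => norm_kry_term_le le_rfl le_rfl j)).hasSum

theorem differentiable_kry (k : ℕ) (x : ℂ) : Differentiable ℂ fun w => kry k w x := by
  intro w
  have h := Complex.differentiableOn_tsum_of_summable_norm (U := Metric.ball (0 : ℂ) (‖w‖ + 1))
    (F := fun (j : ℕ) w => w ^ j * x ^ (4 * j + k) / ((4 * j + k)! : ℂ))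
    (summable_kry_bound k (‖w‖ + 1) ‖x‖) (fun j => by fun_prop) Metric.isOpen_ball
    (fun j z hz => norm_kry_term_le (by simpa using (mem_ball_zero_iff.1 hz).le) le_rfl j)
  exact h.differentiableAt (Metric.isOpen_ball.mem_nhds (by simp))

theorem hasSum_deriv_kry (k : ℕ) (w x : ℂ) :
    HasSum (fun j : ℕ => deriv (fun x : ℂ => w ^ j * x ^ (4 * j + k) / ((4 * j + k)! : ℂ)) x)
      (deriv (kry k w) x) ∧ DifferentiableAt ℂ (kry k w) x := by
  have hb : ∀ (j : ℕ), ∀ z ∈ Metric.ball (0 : ℂ) (‖x‖ + 1),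
      ‖w ^ j * z ^ (4 * j + k) / ((4 * j + k)! : ℂ)‖
        ≤ (‖x‖ + 1) ^ k * ((‖w‖ * (‖x‖ + 1) ^ 4) ^ j / j !) :=
    fun j z hz => norm_kry_term_le le_rfl (by simpa using (mem_ball_zero_iff.1 hz).le) j
  have hx : x ∈ Metric.ball (0 : ℂ) (‖x‖ + 1) := by simp
  have h := Complex.differentiableOn_tsum_of_summable_norm
    (F := fun (j : ℕ) (x : ℂ) => w ^ j * x ^ (4 * j + k) / ((4 * j + k)! : ℂ))
    (summable_kry_bound k ‖w‖ (‖x‖ + 1)) (fun j => by fun_prop) Metric.isOpen_ball hb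
  exact ⟨Complex.hasSum_deriv_of_summable_norm
    (F := fun (j : ℕ) (x : ℂ) => w ^ j * x ^ (4 * j + k) / ((4 * j + k)! : ℂ))
    (summable_kry_bound k ‖w‖ (‖x‖ + 1)) (fun j => by fun_prop) Metric.isOpen_ball hb hx,
    h.differentiableAt (Metric.isOpen_ball.mem_nhds hx)⟩

theorem deriv_kry_term (k j : ℕ) (w x : ℂ) :
    deriv (fun x : ℂ => w ^ j * x ^ (4 * j + (k + 1)) / ((4 * j + (k + 1))! : ℂ)) x =
      w ^ j * x ^ (4 * j + k) / ((4 * j + k)! : ℂ) := by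
  have h : HasDerivAt (fun x : ℂ => w ^ j * x ^ (4 * j + (k + 1)) / ((4 * j + (k + 1))! : ℂ))
      (w ^ j * (((4 * j + k + 1 : ℕ) : ℂ) * x ^ (4 * j + k)) / ((4 * j + (k + 1))! : ℂ)) x :=
    ((hasDerivAt_pow (4 * j + k + 1) x).const_mul (w ^ j)).div_const _
  rw [h.deriv, ← add_assoc, Nat.factorial_succ, Nat.cast_mul]
  have h1 : ((4 * j + k + 1 : ℕ) : ℂ) ≠ 0 := Nat.cast_ne_zero.2 (Nat.succ_ne_zero _)
  have h2 : ((4 * j + k)! : ℂ) ≠ 0 := Nat.cast_ne_zero.2 (Nat.factorial_ne_zero _)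
  field_simp

theorem hasDerivAt_kry_succ (k : ℕ) (w x : ℂ) :
    HasDerivAt (kry (k + 1) w) (kry k w x) x := by
  obtain ⟨h1, h2⟩ := hasSum_deriv_kry (k + 1) w x
  simp only [deriv_kry_term] at h1
  rw [(hasSum_kry k w x).unique h1]
  exact h2.hasDerivAt

theorem hasDerivAt_kry_zero (w x : ℂ) : HasDerivAt (kry 0 w) (w * kry 3 w x) x := by
  obtain ⟨h1, h2⟩ := hasSum_deriv_kry 0 w x
  rw [← hasSum_nat_add_iff' 1] at h1
  have h3 : ∀ j : ℕ, deriv (fun x : ℂ => w ^ (j + 1) * x ^ (4 * (j + 1) + 0) /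
      ((4 * (j + 1) + 0)! : ℂ)) x = w * (w ^ j * x ^ (4 * j + 3) / ((4 * j + 3)! : ℂ)) := by
    intro j
    have := deriv_kry_term 3 j w x
    rw [← this, ← deriv_const_mul_field]
    congr 1
    ext y
    rw [show 4 * (j + 1) + 0 = 4 * j + (3 + 1) by ring]
    ring
  simp only [h3] at h1
  simp only [Finset.range_one, Finset.sum_singleton, pow_zero, mul_zero, zero_add, one_mul,
    Nat.factorial_zero, Nat.cast_one, div_one, deriv_const, sub_zero] at h1
  rw [((hasSum_kry 3 w x).mul_left w).unique h1]
  exact h2.hasDerivAt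

theorem kry_zero_zero (w : ℂ) : kry 0 w 0 = 1 := by
  refine (hasSum_kry 0 w 0).unique ?_
  convert! hasSum_single (f := fun j : ℕ => w ^ j * (0 : ℂ) ^ (4 * j + 0) / ((4 * j + 0)! : ℂ)) 0 ?_
  · simp
  · intro j hj
    simp [hj]

theorem kry_succ_zero (k : ℕ) (w : ℂ) : kry (k + 1) w 0 = 0 := by
  simp [kry]

theorem kry_one_zero_one : kry 1 0 1 = 1 := by
  refine (hasSum_kry 1 0 1).unique ?_
  convert! hasSum_single (f := fun j : ℕ => (0 : ℂ) ^ j * (1 : ℂ) ^ (4 * j + 1) /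
    ((4 * j + 1)! : ℂ)) 0 ?_
  · simp
  · intro j hj
    simp [hj]

/-- The odd series splits by exponent mod 4. The sine differs only in the sign of the second half,
so both are combinations of the same two fundamental solutions. -/
theorem sinh_mul_eq_kry (l x : ℂ) :
    Complex.sinh (l * x) = l * kry 1 (l ^ 4) x + l ^ 3 * kry 3 (l ^ 4) x := by
  refine (Complex.hasSum_sinh (l * x)).unique (HasSum.even_add_odd ?_ ?_)
  · convert! (hasSum_kry 1 (l ^ 4) x).mul_left l using 2 with j
    rw [show 2 * (2 * j) + 1 = 4 * j + 1 by ring]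
    ring
  · convert! (hasSum_kry 3 (l ^ 4) x).mul_left (l ^ 3) using 2 with j
    rw [show 2 * (2 * j + 1) + 1 = 4 * j + 3 by ring]
    ring

theorem sin_mul_eq_kry (l x : ℂ) :
    Complex.sin (l * x) = l * kry 1 (l ^ 4) x - l ^ 3 * kry 3 (l ^ 4) x := by
  rw [sub_eq_add_neg, ← neg_mul]
  refine (Complex.hasSum_sin (l * x)).unique (HasSum.even_add_odd ?_ ?_)
  · convert! (hasSum_kry 1 (l ^ 4) x).mul_left l using 2 with j
    rw [show 2 * (2 * j) + 1 = 4 * j + 1 by ring, pow_mul]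
    simp
    ring
  · convert! (hasSum_kry 3 (l ^ 4) x).mul_left (-l ^ 3) using 2 with j
    rw [show 2 * (2 * j + 1) + 1 = 4 * j + 3 by ring, pow_succ, pow_mul]
    simp
    ring

/-- The solution of `u'''' = w u` with `u(0) = u''(0) = 0`, `u'(0) = A`, `u'''(0) = B`, and its
derivatives. -/
def jet (w A B : ℂ) : ℕ → ℝ → ℂ
  | 0, x => A * kry 1 w x + B * kry 3 w x
  | 1, x => A * kry 0 w x + B * kry 2 w x
  | 2, x => A * (w * kry 3 w x) + B * kry 1 w x
  | 3, x => A * (w * kry 2 w x) + B * kry 0 w x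
  | 4, x => w * (A * kry 1 w x + B * kry 3 w x)
  | _, _ => 0

theorem hasDerivAt_jet (w A B : ℂ) {i : ℕ} (hi : i < 4) (x : ℝ) :
    HasDerivAt (jet w A B i) (jet w A B (i + 1) x) x := by
  have h0 := (hasDerivAt_kry_zero w x).comp_ofReal
  have h1 := (hasDerivAt_kry_succ 0 w x).comp_ofReal
  have h2 := (hasDerivAt_kry_succ 1 w x).comp_ofReal
  have h3 := (hasDerivAt_kry_succ 2 w x).comp_ofReal
  interval_cases i
  · exact (h1.const_mul A).add (h3.const_mul B)
  · exact (h0.const_mul A).add (h2.const_mul B)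
  · exact ((h3.const_mul w).const_mul A).add (h1.const_mul B)
  · have := ((h2.const_mul w).const_mul A).add (h0.const_mul B)
    refine this.congr_deriv ?_
    simp only [jet]; ring

theorem continuous_jet (w A B : ℂ) (i : ℕ) : Continuous (jet w A B i) := by
  have h : ∀ i < 4, Continuous (jet w A B i) := fun i hi =>
    continuous_iff_continuousAt.2 fun x => (hasDerivAt_jet w A B hi x).continuousAt
  rcases lt_or_ge i 4 with hi | hi
  · exact h i hi
  · match i, hi with
    | 4, _ => exact continuous_const.mul (h 0 (by norm_num))
    | n + 5, _ => exact continuous_const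

theorem jet_four (w A B : ℂ) (x : ℝ) : jet w A B 4 x = w * jet w A B 0 x := rfl

theorem jet_zero_at (w A B : ℂ) : jet w A B 0 0 = 0 ∧ jet w A B 1 0 = A ∧ jet w A B 2 0 = 0 ∧
    jet w A B 3 0 = B := by
  simp [jet, kry_zero_zero, kry_succ_zero]

/-! ### The two parts of the characteristic function -/

/-- The free part `sin λ sinh λ / λ ^ 2` of the characteristic function. -/
def charS (w : ℂ) : ℂ := kry 1 w 1 ^ 2 - w * kry 3 w 1 ^ 2

/-- The part of the characteristic function which comes from the point load. -/
def charT (ξ : ℝ) (w : ℂ) : ℂ :=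
  kry 1 w ξ * (kry 3 w 1 * kry 1 w (1 - ξ) - kry 3 w (1 - ξ) * kry 1 w 1) -
    kry 3 w ξ * (kry 1 w 1 * kry 1 w (1 - ξ) - w * kry 3 w 1 * kry 3 w (1 - ξ))

theorem differentiable_charS : Differentiable ℂ charS := by
  have h1 := differentiable_kry 1 1
  have h3 := differentiable_kry 3 1
  unfold charS
  fun_prop

theorem differentiable_charT (ξ : ℝ) : Differentiable ℂ (charT ξ) := by
  have h1 := differentiable_kry 1 1
  have h2 := differentiable_kry 1 ξ
  have h3 := differentiable_kry 1 (1 - ξ)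
  have h4 := differentiable_kry 3 1
  have h5 := differentiable_kry 3 ξ
  have h6 := differentiable_kry 3 (1 - ξ)
  unfold charT
  fun_prop

theorem charS_zero : charS 0 = 1 := by simp [charS, kry_one_zero_one]

theorem sq_mul_charS (l : ℂ) : l ^ 2 * charS (l ^ 4) = Complex.sin l * Complex.sinh l := by
  have h1 := sinh_mul_eq_kry l 1
  have h2 := sin_mul_eq_kry l 1
  rw [mul_one] at h1 h2
  rw [h1, h2, charS]; ring

theorem pow_five_mul_charT (ξ : ℝ) (l : ℂ) : 2 * l ^ 5 * charT ξ (l ^ 4) =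
    Complex.sin (l * (1 - ξ)) * Complex.sin (l * ξ) * Complex.sinh l -
      Complex.sinh (l * (1 - ξ)) * Complex.sinh (l * ξ) * Complex.sin l := by
  have h1 := sinh_mul_eq_kry l 1
  have h2 := sin_mul_eq_kry l 1
  rw [mul_one] at h1 h2
  rw [h1, h2, sinh_mul_eq_kry, sin_mul_eq_kry, sinh_mul_eq_kry, sin_mul_eq_kry, charT]; ring

/-! ### From weak to classical solutions -/

theorem IsSobolev.mono {k : ℕ} {c d c' d' : ℝ} {p : ℕ → ℝ → ℂ} (hp : IsSobolev k c d p)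
    (hc : c ≤ c') (hcd : c' ≤ d') (hd : d' ≤ d) : IsSobolev k c' d' p := by
  refine ⟨fun i hi => ⟨?_, fun x hx => ?_⟩, ?_⟩
  · refine (hp.1 i hi).1.mono_set ?_
    rw [uIcc_of_le hcd, uIcc_of_le (hc.trans (hcd.trans hd))]
    exact Icc_subset_Icc hc hd
  · have hI := (hp.1 i hi).1
    have hsub : ∀ {y z : ℝ}, y ∈ Icc c d → z ∈ Icc c d →
        IntervalIntegrable (p (i + 1)) volume y z := by
      intro y z hy hz
      refine hI.mono_set ?_
      rw [uIcc_of_le (hc.trans (hcd.trans hd))]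
      exact ordConnected_Icc.uIcc_subset hy hz
    have h1 : c ∈ Icc c d := ⟨le_rfl, hc.trans (hcd.trans hd)⟩
    have h2 : c' ∈ Icc c d := ⟨hc, hcd.trans hd⟩
    have h3 : x ∈ Icc c d := ⟨hc.trans hx.1, hx.2.trans hd⟩
    rw [(hp.1 i hi).2 x h3, (hp.1 i hi).2 c' h2,
      ← intervalIntegral.integral_add_adjacent_intervals (hsub h1 h2) (hsub h2 h3), add_assoc]
  · exact hp.2.mono_measure (Measure.restrict_mono (Ioo_subset_Ioo hc hd) le_rfl)

/-- Once the weak derivative has a continuous representative, the fundamental theorem of calculus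
makes it a classical derivative, one-sided at the end points. This upgrades the top derivative,
known only almost everywhere. -/
theorem IsSobolev.hasDerivWithinAt {k : ℕ} {c d : ℝ} {p : ℕ → ℝ → ℂ} {i : ℕ} {g : ℝ → ℂ}
    (hp : IsSobolev k c d p) (hi : i < k) (hcd : c ≤ d) (hg : ContinuousOn g (Icc c d))
    (h : p (i + 1) =ᵐ[volume.restrict (Ioo c d)] g) {x : ℝ} (hx : x ∈ Icc c d) :
    HasDerivWithinAt (p i) (g x) (Icc c d) x := by
  -- A continuous extension to the whole line lets the integral be differentiated at the end points
  -- too.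
  set G : ℝ → ℂ := IccExtend hcd ((Icc c d).domRestrict g) with hG
  have hGc : Continuous G := (continuousOn_iff_continuous_domRestrict.1 hg).Icc_extend'
  have hGg : EqOn G g (Icc c d) := fun y hy => by simp [hG, IccExtend_of_mem hcd _ hy, Set.domRestrict]
  have heq : ∀ y ∈ Icc c d, p i y = p i c + ∫ t in c..y, G t := by
    intro y hy
    rw [(hp.1 i hi).2 y hy]
    congr 1
    refine intervalIntegral.integral_congr_ae_restrict ?_
    rw [uIoc_of_le hy.1]
    have h1 : p (i + 1) =ᵐ[volume.restrict (Ioc c d)] g := by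
      rwa [← restrict_Ioo_eq_restrict_Ioc]
    refine (ae_restrict_of_ae_restrict_of_subset (Ioc_subset_Ioc_right hy.2) h1).mp ?_
    filter_upwards [ae_restrict_mem measurableSet_Ioc] with t ht h2
    rw [h2, hGg ⟨ht.1.le, ht.2.trans hy.2⟩]
  have hd : HasDerivAt (fun y => p i c + ∫ t in c..y, G t) (G x) x :=
    (hGc.integral_hasStrictDerivAt c x).hasDerivAt.const_add _
  rw [← hGg hx]
  exact hd.hasDerivWithinAt.congr (fun y hy => heq y hy) (heq x hx)

theorem IsSobolev.continuousOn {k : ℕ} {c d : ℝ} {p : ℕ → ℝ → ℂ} {i : ℕ}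
    (hp : IsSobolev k c d p) (hi : i < k) (hcd : c ≤ d) : ContinuousOn (p i) (Icc c d) := by
  have h1 : ContinuousOn (fun x => ∫ t in c..x, p (i + 1) t) (uIcc c d) :=
    intervalIntegral.continuousOn_primitive_interval' (hp.1 i hi).1 left_mem_uIcc
  rw [uIcc_of_le hcd] at h1
  exact ((continuousOn_const (c := p i c)).add h1).congr (hp.1 i hi).2

theorem eqOn_Icc_of_ae_eq {c d : ℝ} (hcd : c < d) {f g : ℝ → ℂ}
    (hf : ContinuousOn f (Icc c d)) (hg : ContinuousOn g (Icc c d))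
    (h : f =ᵐ[volume.restrict (Ioo c d)] g) : EqOn f g (Icc c d) :=
  (Measure.eqOn_Ioo_of_ae_eq volume h (hf.mono Ioo_subset_Icc_self)
    (hg.mono Ioo_subset_Icc_self)).of_subset_closure hf hg Ioo_subset_Icc_self
    (by rw [closure_Ioo hcd.ne])

theorem IsSobolev.eqOn_succ {k m : ℕ} {c d : ℝ} {p q : ℕ → ℝ → ℂ} {i : ℕ}
    (hp : IsSobolev k c d p) (hq : IsSobolev m c d q) (hik : i + 1 < k) (him : i + 1 < m)
    (hcd : c < d) (h : EqOn (p i) (q i) (Icc c d)) :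
    EqOn (p (i + 1)) (q (i + 1)) (Icc c d) := by
  intro x hx
  have h1 := hp.hasDerivWithinAt (Nat.lt_of_succ_lt hik) hcd.le (hp.continuousOn hik hcd.le)
    (EventuallyEq.refl _ _) hx
  have h2 := hq.hasDerivWithinAt (Nat.lt_of_succ_lt him) hcd.le (hq.continuousOn him hcd.le)
    (EventuallyEq.refl _ _) hx
  exact (uniqueDiffOn_Icc hcd x hx).eq_deriv _ h1 (h2.congr (fun y hy => h hy) (h hx))

theorem memLp_Ioo_of_continuous {f : ℝ → ℂ} (hf : Continuous f) (c d : ℝ) :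
    MemLp f 2 (volume.restrict (Ioo c d)) := by
  obtain ⟨M, hM⟩ := (isCompact_Icc (a := c) (b := d)).exists_bound_of_continuousOn hf.continuousOn
  refine MemLp.of_bound hf.aestronglyMeasurable M ?_
  filter_upwards [ae_restrict_mem measurableSet_Ioo] with x hx
  exact hM x (Ioo_subset_Icc_self hx)

theorem isSobolev_of_hasDerivAt {k : ℕ} {p : ℕ → ℝ → ℂ} (hc : ∀ i ≤ k, Continuous (p i))
    (h : ∀ i < k, ∀ x, HasDerivAt (p i) (p (i + 1) x) x) (c d : ℝ) : IsSobolev k c d p := by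
  refine ⟨fun i hi => ⟨(hc (i + 1) hi).intervalIntegrable _ _, fun x _ => ?_⟩,
    memLp_Ioo_of_continuous (hc k le_rfl) c d⟩
  rw [intervalIntegral.integral_eq_sub_of_hasDerivAt (fun y _ => h i hi y)
    ((hc (i + 1) hi).intervalIntegrable _ _)]
  ring

/-- `P 0` solves `u'''' = w u` on `[c,d]`, with derivatives `P 1`, `P 2`, `P 3`. -/
def SolvesOn (w : ℂ) (c d : ℝ) (P : ℕ → ℝ → ℂ) : Prop :=
  ∀ x ∈ Icc c d, (∀ i < 3, HasDerivWithinAt (P i) (P (i + 1) x) (Icc c d) x) ∧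
    HasDerivWithinAt (P 3) (w * P 0 x) (Icc c d) x

theorem IsSobolev.solvesOn {w : ℂ} {c d : ℝ} {p : ℕ → ℝ → ℂ} (hp : IsSobolev 4 c d p)
    (hcd : c ≤ d) (h : p 4 =ᵐ[volume.restrict (Ioo c d)] fun x => w * p 0 x) :
    SolvesOn w c d p := fun _ hx =>
  ⟨fun i hi => hp.hasDerivWithinAt (by omega) hcd (hp.continuousOn (by omega) hcd)
    (EventuallyEq.refl _ _) hx,
    hp.hasDerivWithinAt (by norm_num) hcd
      (continuousOn_const.mul (hp.continuousOn (by norm_num) hcd)) h hx⟩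

theorem solvesOn_jet (w A B : ℂ) (c d : ℝ) : SolvesOn w c d (jet w A B) := fun x _ =>
  ⟨fun _ hi => (hasDerivAt_jet w A B (by omega) x).hasDerivWithinAt,
    (hasDerivAt_jet w A B (i := 3) (by norm_num) x).hasDerivWithinAt⟩

theorem hasDerivAt_jet_shift (w A B : ℂ) (ξ : ℝ) {i : ℕ} (hi : i < 4) (x : ℝ) :
    HasDerivAt (fun x => jet w A B i (x - ξ)) (jet w A B (i + 1) (x - ξ)) x :=
  (hasDerivAt_jet w A B hi (x - ξ)).comp_sub_const x ξ

theorem SolvesOn.add {w : ℂ} {c d : ℝ} {P Q : ℕ → ℝ → ℂ} (hP : SolvesOn w c d P)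
    (hQ : SolvesOn w c d Q) : SolvesOn w c d (P + Q) := fun x hx =>
  ⟨fun i hi => ((hP x hx).1 i hi).add ((hQ x hx).1 i hi),
    ((hP x hx).2.add (hQ x hx).2).congr_deriv (mul_add _ _ _).symm⟩

theorem solvesOn_jet_shift (w A B : ℂ) (ξ c d : ℝ) :
    SolvesOn w c d (fun i x => jet w A B i (x - ξ)) := fun x _ =>
  ⟨fun _ hi => (hasDerivAt_jet_shift w A B ξ (by omega) x).hasDerivWithinAt,
    (hasDerivAt_jet_shift w A B ξ (i := 3) (by norm_num) x).hasDerivWithinAt⟩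

/-- Uniqueness for the linear first-order system satisfied by (u, u', u'', u'''). `SolvesOn` uses w
u as derivative of `P 3`, so no pointwise value of a fourth derivative enters. -/
theorem SolvesOn.eqOn {w : ℂ} {c d : ℝ} {P Q : ℕ → ℝ → ℂ} (hP : SolvesOn w c d P)
    (hQ : SolvesOn w c d Q) (h : ∀ i < 4, P i c = Q i c) {i : ℕ} (hi : i < 4) :
    EqOn (P i) (Q i) (Icc c d) := by
  -- The companion matrix (y₀, y₁, y₂, y₃) ↦ (y₁, y₂, y₃, w y₀).
  let L : (Fin 4 → ℂ) →L[ℂ] (Fin 4 → ℂ) := ContinuousLinearMap.pi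
    ![ContinuousLinearMap.proj 1, ContinuousLinearMap.proj 2, ContinuousLinearMap.proj 3,
      w • ContinuousLinearMap.proj 0]
  have key : ∀ R : ℕ → ℝ → ℂ, SolvesOn w c d R → ∀ x ∈ Icc c d,
      HasDerivWithinAt (fun t => fun j : Fin 4 => R j t) (L (fun j : Fin 4 => R j x))
        (Icc c d) x := by
    intro R hR x hx
    rw [hasDerivWithinAt_pi]
    intro j
    obtain ⟨h1, h2⟩ := hR x hx
    fin_cases j
    · exact h1 0 (by norm_num)
    · exact h1 1 (by norm_num)
    · exact h1 2 (by norm_num)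
    · exact h2
  have := ODE_solution_unique_of_mem_Icc_right (v := fun _ => L) (s := fun _ => univ)
    (K := ‖L‖₊) (f := fun t => fun j : Fin 4 => P j t) (g := fun t => fun j : Fin 4 => Q j t)
    (a := c) (b := d) (fun t _ => L.lipschitz.lipschitzOnWith)
    (fun t ht => (key P hP t ht).continuousWithinAt)
    (fun t ht => (key P hP t (Ico_subset_Icc_self ht)).mono_of_mem_nhdsWithin
      (Icc_mem_nhdsGE_of_mem ht)) (fun _ _ => mem_univ _)
    (fun t ht => (key Q hQ t ht).continuousWithinAt)
    (fun t ht => (key Q hQ t (Ico_subset_Icc_self ht)).mono_of_mem_nhdsWithin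
      (Icc_mem_nhdsGE_of_mem ht)) (fun _ _ => mem_univ _)
    (funext fun j => h j j.2)
  intro x hx
  exact congrFun (this hx) ⟨i, hi⟩

/-! ### Eigenvectors and the characteristic equation -/

/-- The boundary and transmission conditions for the coefficients of a solution. -/
def LoadEq (κ : ℂ) (ξ : ℝ) (w A B C : ℂ) : Prop :=
  jet w A B 0 1 + jet w 0 C 0 (1 - ξ) = 0 ∧ jet w A B 2 1 + jet w 0 C 2 (1 - ξ) = 0 ∧
    C = -(κ * jet w A B 0 ξ)

/-- The conditions are a homogeneous system in (A, B, C) with determinant S + κT. A nontrivial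
kernel vector automatically has A or B nonzero, because A = B = 0 forces C = 0 by the jump law. -/
theorem exists_loadEq_iff (κ : ℂ) (ξ : ℝ) (w : ℂ) :
    (∃ A B C : ℂ, (A ≠ 0 ∨ B ≠ 0) ∧ LoadEq κ ξ w A B C) ↔ charS w + κ * charT ξ w = 0 := by
  set M : Matrix (Fin 3) (Fin 3) ℂ := !![kry 1 w 1, kry 3 w 1, kry 3 w (1 - ξ);
    w * kry 3 w 1, kry 1 w 1, kry 1 w (1 - ξ); κ * kry 1 w ξ, κ * kry 3 w ξ, 1] with hM
  have hdet : M.det = charS w + κ * charT ξ w := by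
    rw [hM, Matrix.det_fin_three, charS, charT]
    simp
    ring
  have hv : ∀ A B C : ℂ, M.mulVec ![A, B, C] = 0 ↔ LoadEq κ ξ w A B C := by
    intro A B C
    rw [LoadEq, hM]
    simp only [jet, Matrix.mulVec, dotProduct, funext_iff, Fin.forall_fin_succ, Fin.sum_univ_succ]
    simp
    refine and_congr ?_ (and_congr ?_ ?_)
    · constructor <;> intro h <;> linear_combination h
    · constructor <;> intro h <;> linear_combination h
    · constructor <;> intro h <;> linear_combination h
  rw [← hdet, ← Matrix.exists_mulVec_eq_zero_iff]
  constructor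
  · rintro ⟨A, B, C, hne, h⟩
    refine ⟨![A, B, C], ?_, (hv A B C).2 h⟩
    intro h0
    rcases hne with h1 | h1
    · exact h1 (congrFun h0 0)
    · exact h1 (congrFun h0 1)
  · rintro ⟨v, hne, h⟩
    have hvv : v = ![v 0, v 1, v 2] := by
      ext j; fin_cases j <;> rfl
    rw [hvv] at h
    have hL := (hv _ _ _).1 h
    refine ⟨v 0, v 1, v 2, ?_, hL⟩
    by_contra! h0
    have h2 := hL.2.2
    rw [h0.1, h0.2] at h2
    simp only [jet, zero_mul, add_zero, mul_zero, neg_zero] at h2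
    apply hne
    rw [hvv, h0.1, h0.2, h2]
    ext j; fin_cases j <;> rfl

/-- The function with derivatives `jet w A B` to which the solution generated by a point load of
size `C` at `ξ` is added, and its derivatives. -/
def profile (ξ : ℝ) (w A B C : ℂ) (i : ℕ) (x : ℝ) : ℂ :=
  jet w A B i x + if ξ ≤ x then jet w 0 C i (x - ξ) else 0

theorem hasDerivAt_truncate {g : ℝ → ℂ} {g' : ℝ → ℂ} (hg : ∀ x, HasDerivAt g (g' x) x) (ξ : ℝ)
    (h0 : g ξ = 0) (h1 : g' ξ = 0) (x : ℝ) :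
    HasDerivAt (fun x => if ξ ≤ x then g x else 0) (if ξ ≤ x then g' x else 0) x := by
  rcases lt_trichotomy x ξ with h | rfl | h
  · rw [if_neg h.not_ge]
    refine (hasDerivAt_const x (0 : ℂ)).congr_of_eventuallyEq ?_
    filter_upwards [Iio_mem_nhds h] with y hy
    exact if_neg (not_le.2 hy)
  · rw [if_pos le_rfl, h1]
    rw [← hasDerivWithinAt_univ, ← Iic_union_Ici (a := x)]
    refine HasDerivWithinAt.union ?_ ?_
    · refine (hasDerivAt_const x (0 : ℂ)).hasDerivWithinAt.congr (fun y hy => ?_) (by simp [h0])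
      split_ifs with h
      · rw [le_antisymm hy h, h0]
      · rfl
    · refine ((hg x).hasDerivWithinAt.congr_deriv h1).congr (fun y hy => if_pos hy)
        (if_pos le_rfl)
  · rw [if_pos h.le]
    refine (hg x).congr_of_eventuallyEq ?_
    filter_upwards [Ioi_mem_nhds h] with y hy
    exact if_pos (le_of_lt hy)

/-- The shifted solution generated by the load vanishes at ξ together with its first two
derivatives, so cutting it off there keeps the profile C² and leaves a jump only in the third
derivative. -/
theorem hasDerivAt_profile (ξ : ℝ) (w A B C : ℂ) {i : ℕ} (hi : i < 2) (x : ℝ) :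
    HasDerivAt (profile ξ w A B C i) (profile ξ w A B C (i + 1) x) x := by
  refine (hasDerivAt_jet w A B (by omega) x).add (hasDerivAt_truncate
    (fun x => hasDerivAt_jet_shift w 0 C ξ (by omega) x) ξ ?_ ?_ x)
  · obtain ⟨h0, h1, h2, -⟩ := jet_zero_at w 0 C
    interval_cases i <;> simp [h0, h1]
  · obtain ⟨h0, h1, h2, -⟩ := jet_zero_at w 0 C
    interval_cases i <;> simp [h1, h2]

theorem continuous_profile (ξ : ℝ) (w A B C : ℂ) {i : ℕ} (hi : i ≤ 2) :
    Continuous (profile ξ w A B C i) := by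
  refine (continuous_jet w A B i).add (Continuous.if_le ((continuous_jet w 0 C i).comp
    (continuous_id.sub continuous_const)) continuous_const continuous_const continuous_id ?_)
  rintro x rfl
  obtain ⟨h0, h1, h2, -⟩ := jet_zero_at w 0 C
  interval_cases i <;> simp [h0, h1, h2]

theorem isSobolev_profile (ξ : ℝ) (w A B C : ℂ) : IsSobolev 2 0 1 (profile ξ w A B C) :=
  isSobolev_of_hasDerivAt (fun _ hi => continuous_profile ξ w A B C hi)
    (fun _ hi x => hasDerivAt_profile ξ w A B C hi x) 0 1

theorem isEigenfunction_profile {a b α : ℝ} (ξ : Ioo (0 : ℝ) 1) {μ w A B C : ℂ}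
    (hw : (a : ℂ) * w = -(b * μ + μ ^ 2)) (hne : A ≠ 0 ∨ B ≠ 0)
    (hL : LoadEq ((α / a : ℝ) * μ) ξ w A B C) :
    IsEigenfunction (Beam.A a b α ξ) μ
      (fun x => (profile ξ w A B C 0 x, μ * profile ξ w A B C 0 x)) := by
  obtain ⟨hL1, hL2, hL3⟩ := hL
  obtain ⟨hξ0, hξ1⟩ := ξ.2
  obtain ⟨hj0, hj1, hj2, hj3⟩ := jet_zero_at w A B
  obtain ⟨hk0, hk1, hk2, hk3⟩ := jet_zero_at w 0 C
  set P := profile ξ w A B C with hP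
  have hPc : Continuous (P 0) := continuous_profile _ _ _ _ _ (by norm_num)
  have hmem := memLp_Ioo_of_continuous hPc 0 1
  have hP0 : P 0 0 = 0 := by simp [hP, profile, hj0, hξ0.not_ge]
  have hP1 : P 0 1 = 0 := by simp [hP, profile, hξ1.le, hL1]
  let f : L2 := hmem.toLp _
  have hf : (f : ℝ → ℂ) =ᵐ[volume.restrict (Ioo 0 1)] P 0 := hmem.coeFn_toLp
  have hfV : f ∈ V := ⟨P, isSobolev_profile _ _ _ _ _, hP0, hP1, hf⟩
  have hμf : ((μ • f : L2) : ℝ → ℂ) =ᵐ[volume.restrict (Ioo 0 1)] fun x => μ * P 0 x := by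
    filter_upwards [Lp.coeFn_smul μ f, hf] with x h1 h2
    rw [h1, Pi.smul_apply, h2, smul_eq_mul]
  let U : Energy := (⟨f, hfV⟩, μ • f)
  have hleft : EqOn (P 0) (jet w A B 0) (Ioo 0 (ξ : ℝ)) := by
    intro x hx
    simp [hP, profile, hx.2.not_ge]
  have hright : EqOn (P 0) (fun x => jet w A B 0 x + jet w 0 C 0 (x - ξ)) (Ioo (ξ : ℝ) 1) := by
    intro x hx
    simp [hP, profile, hx.1.le]
  have hfl := ae_restrict_of_Ioo (c := 0) (d := ξ) le_rfl hξ1.le hf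
  have hfr := ae_restrict_of_Ioo (c := ξ) (d := 1) hξ0.le le_rfl hf
  have hml := ae_restrict_of_Ioo (c := 0) (d := ξ) le_rfl hξ1.le hμf
  have hmr := ae_restrict_of_Ioo (c := ξ) (d := 1) hξ0.le le_rfl hμf
  have h2f := Lp.coeFn_smul μ (μ • f)
  have h2l := ae_restrict_of_Ioo (c := 0) (d := ξ) le_rfl hξ1.le h2f
  have h2r := ae_restrict_of_Ioo (c := ξ) (d := 1) hξ0.le le_rfl h2f
  have hgraph : InGraph a b α ξ U (μ • U) := by
    refine ⟨rfl, jet w A B, fun i x => jet w A B i x + jet w 0 C i (x - ξ), fun i x => μ * P i x,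
      isSobolev_of_hasDerivAt (fun i _ => continuous_jet w A B i)
        (fun i hi x => hasDerivAt_jet w A B hi x) _ _,
      isSobolev_of_hasDerivAt (fun i _ => (continuous_jet w A B i).add
        ((continuous_jet w 0 C i).comp (continuous_id.sub continuous_const)))
        (fun i hi x => (hasDerivAt_jet w A B hi x).add (hasDerivAt_jet_shift w 0 C ξ hi x)) _ _,
      (isSobolev_profile _ _ _ _ _).smul μ, ?_, ?_, hμf, hj2, hL2, ?_, ?_, ?_, ?_⟩
    · filter_upwards [hfl, ae_restrict_mem measurableSet_Ioo] with x h1 h2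
      exact h1.trans (hleft h2)
    · filter_upwards [hfr, ae_restrict_mem measurableSet_Ioo] with x h1 h2
      exact h1.trans (hright h2)
    · simp [hk2]
    · have : P 0 ξ = jet w A B 0 ξ := by simp [hP, profile, hk0]
      simp only [sub_self, hk3, this]
      linear_combination hL3
    · filter_upwards [hml, h2l, ae_restrict_mem measurableSet_Ioo] with x h1 h2 h3
      refine h2.trans ?_
      have h4 : (U.2 : ℝ → ℂ) x = μ * P 0 x := h1
      rw [h4, Pi.smul_apply, h1, hleft h3, jet_four, smul_eq_mul]
      linear_combination jet w A B 0 x * hw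
    · filter_upwards [hmr, h2r, ae_restrict_mem measurableSet_Ioo] with x h1 h2 h3
      refine h2.trans ?_
      have h4 : (U.2 : ℝ → ℂ) x = μ * P 0 x := h1
      rw [h4, Pi.smul_apply, h1, hright h3, jet_four, jet_four, smul_eq_mul]
      linear_combination (jet w A B 0 x + jet w 0 C 0 (x - ξ)) * hw
  rw [← mem_graph_A_iff, LinearPMap.mem_graph_iff] at hgraph
  obtain ⟨y, hy1, hy2⟩ := hgraph
  refine ⟨y, ⟨?_, ?_⟩, ?_, ?_⟩
  -- If the eigenvector vanished, so would the solution on (0, ξ), hence its first and third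
  -- derivatives at 0, which are A and B.
  · rintro rfl
    have hU : U = 0 := hy1.symm
    have hf0 : f = 0 := congrArg (fun W : Energy => (W.1 : L2)) hU
    have hz : (0 : ℝ → ℂ) =ᵐ[volume.restrict (Ioo 0 1)] P 0 := by
      rw [hf0] at hf
      exact (Lp.coeFn_zero ℂ 2 _).symm.trans hf
    have hz0 := Measure.eqOn_Ioo_of_ae_eq volume hz continuousOn_const hPc.continuousOn
    have hJ : IsSobolev 4 0 ξ (jet w A B) := isSobolev_of_hasDerivAt
      (fun i _ => continuous_jet w A B i) (fun i hi x => hasDerivAt_jet w A B hi x) _ _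
    have hZ : IsSobolev 4 0 ξ 0 := IsSobolev.zero _ _ _
    have e0 : EqOn (jet w A B 0) ((0 : ℕ → ℝ → ℂ) 0) (Icc 0 (ξ : ℝ)) := by
      refine EqOn.of_subset_closure (s := Ioo 0 (ξ : ℝ)) (fun x hx => ?_)
        (continuous_jet w A B 0).continuousOn continuousOn_const Ioo_subset_Icc_self
        (by rw [closure_Ioo hξ0.ne])
      rw [← hleft hx]
      exact (hz0 ⟨hx.1, hx.2.trans hξ1⟩).symm
    have e1 := hJ.eqOn_succ hZ (by norm_num) (by norm_num) hξ0 e0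
    have e2 := hJ.eqOn_succ hZ (by norm_num) (by norm_num) hξ0 e1
    have e3 := hJ.eqOn_succ hZ (by norm_num) (by norm_num) hξ0 e2
    have m0 : (0 : ℝ) ∈ Icc 0 (ξ : ℝ) := ⟨le_rfl, hξ0.le⟩
    rcases hne with h | h
    · exact h (hj1.symm.trans (e1 m0))
    · exact h (hj3.symm.trans (e3 m0))
  · rw [hy2, hy1]
  · rw [hy1]; exact hf
  · rw [hy1]; exact hμf

/-- Continuous representatives on the two sides are classical solutions of u'''' = w u, hence
determined by their jets at 0 and at ξ. The H² representative on all of (0,1) supplies the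
continuity of u and u' at ξ. The domain supplies that of u'', so the third derivative is the only
one that can jump. -/
theorem exists_loadEq_of_isEigenvalue {a b α : ℝ} (ha : a ≠ 0) (ξ : Ioo (0 : ℝ) 1) {μ w : ℂ}
    (hw : (a : ℂ) * w = -(b * μ + μ ^ 2)) (h : IsEigenvalue (Beam.A a b α ξ) μ) :
    ∃ A B C : ℂ, (A ≠ 0 ∨ B ≠ 0) ∧ LoadEq ((α / a : ℝ) * μ) ξ w A B C := by
  obtain ⟨y, hy0, hy⟩ := h
  obtain ⟨hξ0, hξ1⟩ := ξ.2
  have ha' : (a : ℂ) ≠ 0 := by exact_mod_cast ha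
  have hg : InGraph a b α ξ y (μ • (y : Energy)) := by
    rw [← mem_graph_A_iff, ← hy]
    exact LinearPMap.mem_graph _ y
  obtain ⟨U, hU⟩ : ∃ U : Energy, (y : Energy) = U := ⟨_, rfl⟩
  rw [hU] at hg
  have hU0 : U ≠ 0 := by
    rw [← hU]
    exact fun h0 => hy0 (Subtype.ext h0)
  obtain ⟨hv, l, r, q, hl, hr, hq, ul, ur, vq, l2, r2, e2, e3, gl, gr⟩ := hg
  obtain ⟨p, hp, hp0, hp1, hup⟩ := U.1.2
  have hv' : U.2 = μ • (U.1 : L2) := hv.symm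
  have hvu : (U.2 : ℝ → ℂ) =ᵐ[volume.restrict (Ioo 0 1)] fun x => μ * p 0 x := by
    rw [hv']
    filter_upwards [Lp.coeFn_smul μ (U.1 : L2), hup] with x h1 h2
    rw [h1, Pi.smul_apply, h2, smul_eq_mul]
  have hvv : (((μ • U).2 : L2) : ℝ → ℂ) =ᵐ[volume.restrict (Ioo 0 1)]
      fun x => μ * (μ * p 0 x) := by
    filter_upwards [Lp.coeFn_smul μ U.2, hvu] with x h1 h2
    refine h1.trans ?_
    rw [Pi.smul_apply, h2, smul_eq_mul]
  have hpl := hp.mono (c' := 0) (d' := ξ) le_rfl hξ0.le hξ1.le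
  have hpr := hp.mono (c' := ξ) (d' := 1) hξ0.le hξ1.le le_rfl
  have hl0 : EqOn (l 0) (p 0) (Icc 0 (ξ : ℝ)) := eqOn_Icc_of_ae_eq hξ0
    (hl.continuousOn (by norm_num) hξ0.le) (hpl.continuousOn (by norm_num) hξ0.le)
    (ul.symm.trans (ae_restrict_of_Ioo le_rfl hξ1.le hup))
  have hr0 : EqOn (r 0) (p 0) (Icc (ξ : ℝ) 1) := eqOn_Icc_of_ae_eq hξ1
    (hr.continuousOn (by norm_num) hξ1.le) (hpr.continuousOn (by norm_num) hξ1.le)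
    (ur.symm.trans (ae_restrict_of_Ioo hξ0.le le_rfl hup))
  have hl1 := hl.eqOn_succ hpl (by norm_num) (by norm_num) hξ0 hl0
  have hr1 := hr.eqOn_succ hpr (by norm_num) (by norm_num) hξ1 hr0
  have hq0 : EqOn (q 0) (fun x => μ * p 0 x) (Icc 0 1) := eqOn_Icc_of_ae_eq one_pos
    (hq.continuousOn (by norm_num) zero_le_one)
    (continuousOn_const.mul (hp.continuousOn (by norm_num) zero_le_one)) (vq.symm.trans hvu)
  have m0 : (0 : ℝ) ∈ Icc 0 (ξ : ℝ) := ⟨le_rfl, hξ0.le⟩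
  have mξ : (ξ : ℝ) ∈ Icc 0 (ξ : ℝ) := ⟨hξ0.le, le_rfl⟩
  have mξ' : (ξ : ℝ) ∈ Icc (ξ : ℝ) 1 := ⟨le_rfl, hξ1.le⟩
  have m1 : (1 : ℝ) ∈ Icc (ξ : ℝ) 1 := ⟨hξ1.le, le_rfl⟩
  have sl : SolvesOn w 0 ξ l := by
    refine hl.solvesOn hξ0.le ?_
    filter_upwards [gl, ae_restrict_of_Ioo (c := 0) (d := ξ) le_rfl hξ1.le hvv,
      ae_restrict_of_Ioo (c := 0) (d := ξ) le_rfl hξ1.le hvu,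
      ae_restrict_mem measurableSet_Ioo] with x h1 h2 h3 h4
    rw [hl0 (Ioo_subset_Icc_self h4)]
    rw [h2, h3] at h1
    apply mul_left_cancel₀ ha'
    linear_combination h1 - p 0 x * hw
  have sr : SolvesOn w ξ 1 r := by
    refine hr.solvesOn hξ1.le ?_
    filter_upwards [gr, ae_restrict_of_Ioo (c := ξ) (d := 1) hξ0.le le_rfl hvv,
      ae_restrict_of_Ioo (c := ξ) (d := 1) hξ0.le le_rfl hvu,
      ae_restrict_mem measurableSet_Ioo] with x h1 h2 h3 h4
    rw [hr0 (Ioo_subset_Icc_self h4)]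
    rw [h2, h3] at h1
    apply mul_left_cancel₀ ha'
    linear_combination h1 - p 0 x * hw
  obtain ⟨hj0, hj1, hj2, hj3⟩ := jet_zero_at w (l 1 0) (l 3 0)
  have el : ∀ i < 4, EqOn (l i) (jet w (l 1 0) (l 3 0) i) (Icc 0 (ξ : ℝ)) := by
    intro i hi
    refine sl.eqOn (solvesOn_jet _ _ _ _ _) (fun i hi => ?_) hi
    interval_cases i
    · rw [hl0 m0, hp0, hj0]
    · exact hj1.symm
    · rw [l2, hj2]
    · exact hj3.symm
  obtain ⟨hk0, hk1, hk2, hk3⟩ := jet_zero_at w 0 (r 3 ξ - l 3 ξ)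
  -- On the right, the left solution is continued past ξ and corrected by the solution with jet (0,
  -- 0, 0, jump) at ξ.
  have er : ∀ i < 4, EqOn (r i) (fun x => jet w (l 1 0) (l 3 0) i x +
      jet w 0 (r 3 ξ - l 3 ξ) i (x - ξ)) (Icc (ξ : ℝ) 1) := by
    intro i hi
    refine sr.eqOn ((solvesOn_jet w _ _ _ _).add (solvesOn_jet_shift w 0 _ ξ _ _))
      (fun i hi => ?_) hi
    simp only [Pi.add_apply, sub_self]
    rw [← el i hi mξ]
    interval_cases i
    · rw [hk0, hr0 mξ', hl0 mξ, add_zero]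
    · rw [hk1, hr1 mξ', hl1 mξ, add_zero]
    · rw [hk2, e2, add_zero]
    · rw [hk3]; ring
  have hC : r 3 ξ - l 3 ξ = -((α / a : ℝ) * μ * jet w (l 1 0) (l 3 0) 0 ξ) := by
    rw [e3, hq0 ⟨hξ0.le, hξ1.le⟩, ← el 0 (by norm_num) mξ, hl0 mξ]; ring
  refine ⟨l 1 0, l 3 0, r 3 ξ - l 3 ξ, ?_, ?_, ?_, hC⟩
  · by_contra! h0
    rw [h0.1, h0.2] at hC
    have hC0 : r 3 ξ - l 3 ξ = 0 := by simpa [jet] using hC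
    have pl : ∀ x ∈ Icc 0 (ξ : ℝ), p 0 x = 0 := by
      intro x hx
      rw [← hl0 hx, el 0 (by norm_num) hx, h0.1, h0.2]
      simp [jet]
    have pr : ∀ x ∈ Icc (ξ : ℝ) 1, p 0 x = 0 := by
      intro x hx
      rw [← hr0 hx, er 0 (by norm_num) hx, h0.1, h0.2, hC0]
      simp [jet]
    have hu0 : (U.1 : L2) = 0 := by
      refine Lp.ext (EventuallyEq.trans ?_ (Lp.coeFn_zero ℂ 2 _).symm)
      filter_upwards [hup, ae_restrict_mem measurableSet_Ioo] with x h1 h2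
      rw [h1]
      rcases le_total x ξ with h | h
      · exact pl x ⟨h2.1.le, h⟩
      · exact pr x ⟨h, h2.2.le⟩
    apply hU0
    refine Prod.ext (Subtype.ext hu0) ?_
    rw [hv', hu0, smul_zero]; rfl
  · exact (er 0 (by norm_num) m1).symm.trans ((hr0 m1).trans hp1)
  · exact (er 2 (by norm_num) m1).symm.trans r2

theorem isEigenvalue_iff {a b α : ℝ} (ha : a ≠ 0) (ξ : Ioo (0 : ℝ) 1) {μ w : ℂ}
    (hw : (a : ℂ) * w = -(b * μ + μ ^ 2)) :
    IsEigenvalue (Beam.A a b α ξ) μ ↔ charS w + (α / a : ℝ) * μ * charT ξ w = 0 := by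
  rw [← exists_loadEq_iff]
  constructor
  · exact exists_loadEq_of_isEigenvalue ha ξ hw
  · rintro ⟨A, B, C, hne, hL⟩
    obtain ⟨U, hU, -⟩ := isEigenfunction_profile ξ hw hne hL
    exact ⟨U, hU⟩

/-! ### Continuous branches of zeros of f + α g -/

/-- Factor h = (z - z₀)^k G with G(z₀) ≠ 0. Since G/G(z₀) is close to 1, its principal k-th root is
analytic, and ψ is z - z₀ times this root and a k-th root of G(z₀). -/
theorem exists_local_root {h : ℂ → ℂ} {z₀ : ℂ} (hh : AnalyticAt ℂ h z₀) (h0 : h z₀ = 0)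
    (hne : ¬ ∀ᶠ z in 𝓝 z₀, h z = 0) :
    ∃ k : ℕ, k ≠ 0 ∧ ∃ ψ : ℂ → ℂ, AnalyticAt ℂ ψ z₀ ∧ deriv ψ z₀ ≠ 0 ∧ ψ z₀ = 0 ∧
      ∀ᶠ z in 𝓝 z₀, h z = ψ z ^ k := by
  obtain ⟨k, g, hg, hg0, hgh⟩ := hh.exists_eventuallyEq_pow_smul_nonzero_iff.2 hne
  have hk : k ≠ 0 := by
    rintro rfl
    have := hgh.self_of_nhds
    rw [h0] at this
    simp [hg0.symm] at this
  obtain ⟨c, hc⟩ : ∃ c : ℂ, c ^ k = g z₀ := ⟨_, Complex.cpow_nat_inv_pow _ hk⟩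
  have hc0 : c ≠ 0 := by
    rintro rfl
    rw [zero_pow hk] at hc
    exact hg0 hc.symm
  have hq : AnalyticAt ℂ (fun z => (g z / g z₀) ^ ((k : ℂ)⁻¹)) z₀ := by
    refine AnalyticAt.cpow (hg.div analyticAt_const hg0) analyticAt_const ?_
    rw [div_self hg0]
    exact Complex.one_mem_slitPlane
  have hψ : AnalyticAt ℂ (fun z => (z - z₀) * (c * (g z / g z₀) ^ ((k : ℂ)⁻¹))) z₀ :=
    (analyticAt_id.sub analyticAt_const).mul (analyticAt_const.mul hq)
  refine ⟨k, hk, _, hψ, ?_, by simp, ?_⟩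
  · have h1 := ((hasDerivAt_id z₀).sub_const z₀).mul
      (hq.differentiableAt.hasDerivAt.const_mul c)
    have h2 : HasDerivAt (fun z => (z - z₀) * (c * (g z / g z₀) ^ ((k : ℂ)⁻¹))) c z₀ := by
      refine h1.congr_deriv ?_
      simp [hg0]
    rw [h2.deriv]
    exact hc0
  · filter_upwards [hgh] with z hz
    rw [hz, mul_pow, mul_pow, Complex.cpow_nat_inv_pow _ hk, hc, smul_eq_mul,
      mul_div_cancel₀ _ hg0]

/-- Glue s^(1/k) for s ≥ 0 to ω|s|^(1/k) for s ≤ 0, where ω^k = -1. Such a root exists because the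
parameter is real; around 0 in the complex plane there is none when k > 1. -/
theorem exists_continuous_real_root {k : ℕ} (hk : k ≠ 0) :
    ∃ ρ : ℝ → ℂ, Continuous ρ ∧ ∀ s, ρ s ^ k = s := by
  obtain ⟨ω, hω⟩ : ∃ ω : ℂ, ω ^ k = -1 := ⟨_, Complex.cpow_nat_inv_pow _ hk⟩
  have hk' : (0 : ℝ) < (k : ℝ)⁻¹ := inv_pos.2 (Nat.cast_pos.2 (Nat.pos_of_ne_zero hk))
  refine ⟨fun s => (max s 0 ^ ((k : ℝ)⁻¹) : ℝ) + ω * (max (-s) 0 ^ ((k : ℝ)⁻¹) : ℝ), ?_, ?_⟩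
  · have h1 : Continuous fun s : ℝ => max s 0 ^ ((k : ℝ)⁻¹) :=
      (continuous_id.max continuous_const).rpow_const fun _ => Or.inr hk'.le
    have h2 : Continuous fun s : ℝ => max (-s) 0 ^ ((k : ℝ)⁻¹) :=
      (continuous_neg.max continuous_const).rpow_const fun _ => Or.inr hk'.le
    exact (Complex.continuous_ofReal.comp h1).add
      (continuous_const.mul (Complex.continuous_ofReal.comp h2))
  · intro s
    rcases le_total 0 s with h | h
    · simp only [max_eq_left h, max_eq_right (neg_nonpos.2 h), Real.zero_rpow hk'.ne',
        Complex.ofReal_zero, mul_zero, add_zero]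
      rw [← Complex.ofReal_pow, Real.rpow_inv_natCast_pow h hk]
    · simp only [max_eq_right h, max_eq_left (neg_nonneg.2 h), Real.zero_rpow hk'.ne',
        Complex.ofReal_zero, zero_add, mul_pow, hω]
      rw [← Complex.ofReal_pow, Real.rpow_inv_natCast_pow (neg_nonneg.2 h) hk]
      push_cast; ring

/-- Finitely many continuous functions on `S` describe the zeros of `f + α g` in `Ω`, for all
`α ∈ S`. -/
def HasBranches (f g : ℂ → ℂ) (Ω : Set ℂ) (S : Set ℝ) : Prop :=
  ∃ G : Set (ℝ → ℂ), G.Finite ∧ (∀ γ ∈ G, ContinuousOn γ S) ∧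
    ∀ α ∈ S, ∀ μ : ℂ, (μ ∈ Ω ∧ f μ + α * g μ = 0) ↔ ∃ γ ∈ G, γ α = μ

theorem HasBranches.mono {f g : ℂ → ℂ} {Ω : Set ℂ} {S S' : Set ℝ} (h : HasBranches f g Ω S)
    (hS : S' ⊆ S) : HasBranches f g Ω S' := by
  obtain ⟨G, h1, h2, h3⟩ := h
  exact ⟨G, h1, fun γ hγ => (h2 γ hγ).mono hS, fun α hα => h3 α (hS hα)⟩

/-- Concatenate every left branch with every right branch that agrees with it at t. Each branch has
such a partner, since its value at t is a zero and both families list all zeros there. -/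
theorem HasBranches.glue {f g : ℂ → ℂ} {Ω : Set ℂ} {s t u : ℝ} (hst : s ≤ t) (htu : t ≤ u)
    (h : HasBranches f g Ω (Icc s t)) (h' : HasBranches f g Ω (Icc t u)) :
    HasBranches f g Ω (Icc s u) := by
  obtain ⟨G, h1, h2, h3⟩ := h
  obtain ⟨G', h1', h2', h3'⟩ := h'
  have ht : t ∈ Icc s t := ⟨hst, le_rfl⟩
  have ht' : t ∈ Icc t u := ⟨le_rfl, htu⟩
  refine ⟨{x | ∃ γ ∈ G, ∃ η ∈ G', γ t = η t ∧ x = fun α => if α ≤ t then γ α else η α}, ?_, ?_, ?_⟩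
  · refine (h1.image2 (fun γ η α => if α ≤ t then γ α else η α) h1').subset ?_
    rintro x ⟨γ, hγ, η, hη, -, rfl⟩
    exact ⟨γ, hγ, η, hη, rfl⟩
  · rintro x ⟨γ, hγ, η, hη, he, rfl⟩
    rw [← Icc_union_Icc_eq_Icc hst htu]
    refine ContinuousOn.union_of_isClosed ?_ ?_ isClosed_Icc isClosed_Icc
    · exact (h2 γ hγ).congr fun α hα => if_pos hα.2
    · refine (h2' η hη).congr fun α hα => ?_
      rcases hα.1.eq_or_lt with rfl | h
      · simp [he]
      · exact if_neg h.not_ge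
  · intro α hα μ
    rcases le_or_gt α t with h | h
    · rw [h3 α ⟨hα.1, h⟩ μ]
      constructor
      · rintro ⟨γ, hγ, rfl⟩
        obtain ⟨η, hη, he⟩ := (h3' t ht' (γ t)).1 ((h3 t ht (γ t)).2 ⟨γ, hγ, rfl⟩)
        exact ⟨_, ⟨γ, hγ, η, hη, he.symm, rfl⟩, if_pos h⟩
      · rintro ⟨_, ⟨γ, hγ, η, hη, he, rfl⟩, rfl⟩
        exact ⟨γ, hγ, (if_pos h).symm⟩
    · rw [h3' α ⟨h.le, hα.2⟩ μ]
      constructor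
      · rintro ⟨η, hη, rfl⟩
        obtain ⟨γ, hγ, he⟩ := (h3 t ht (η t)).1 ((h3' t ht' (η t)).2 ⟨η, hη, rfl⟩)
        exact ⟨_, ⟨γ, hγ, η, hη, he, rfl⟩, if_neg h.not_ge⟩
      · rintro ⟨_, ⟨γ, hγ, η, hη, he, rfl⟩, rfl⟩
        exact ⟨η, hη, (if_neg h.not_ge).symm⟩

/-- Dividing by g turns f + α g = 0 into ψ^k = α - α₀ for a local coordinate ψ. The solutions are
ψ⁻¹(ζ ρ(α - α₀)), with ζ^k = 1 and ρ a continuous k-th root on the line. -/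
theorem exists_local_hasBranches {f g : ℂ → ℂ} (hf : Differentiable ℂ f)
    (hg : Differentiable ℂ g) {α₀ : ℝ} {z₀ : ℂ} (h0 : f z₀ + α₀ * g z₀ = 0) (hg0 : g z₀ ≠ 0)
    (hne : ¬ ∀ᶠ z in 𝓝 z₀, f z + α₀ * g z = 0) {O : Set ℂ} (hO : O ∈ 𝓝 z₀) :
    ∃ U : Set ℂ, IsOpen U ∧ z₀ ∈ U ∧ U ⊆ O ∧ ∃ N ∈ 𝓝 α₀, HasBranches f g U N := by
  set h : ℂ → ℂ := fun z => -(f z + α₀ * g z) / g z with hh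
  have hfa : AnalyticAt ℂ f z₀ := hf.analyticAt z₀
  have hga : AnalyticAt ℂ g z₀ := hg.analyticAt z₀
  have hha : AnalyticAt ℂ h z₀ := ((hfa.add (analyticAt_const.mul hga)).neg).div hga hg0
  have hgn : ∀ᶠ z in 𝓝 z₀, g z ≠ 0 := hga.continuousAt.eventually_ne hg0
  have hhne : ¬ ∀ᶠ z in 𝓝 z₀, h z = 0 := by
    intro H
    apply hne
    filter_upwards [H, hgn] with z h1 h2
    simpa [hh, h2, div_eq_zero_iff, neg_eq_zero, -neg_add_rev] using h1
  obtain ⟨k, hk, ψ, hψ, hψ', hψ0, hψk⟩ := exists_local_root hha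
    (by rw [hh]; simp only [h0, neg_zero, zero_div]) hhne
  obtain ⟨ρ, hρ, hρk⟩ := exists_continuous_real_root hk
  set e : OpenPartialHomeomorph ℂ ℂ :=
    (hψ.hasStrictDerivAt.hasStrictFDerivAt_equiv hψ').toOpenPartialHomeomorph ψ with he
  have hez : z₀ ∈ e.source := HasStrictFDerivAt.mem_toOpenPartialHomeomorph_source _
  have heψ : ∀ z, e z = ψ z := fun z => rfl
  obtain ⟨W, hW, hWo, hzW⟩ := mem_nhds_iff.1 (inter_mem hO (inter_mem hgn hψk))
  have hR0 : z₀ ∈ (e.restrOpen W hWo).source := ⟨hez, hzW⟩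
  set R := e.restrOpen W hWo with hR
  have hRψ : ∀ z, R z = ψ z := fun z => rfl
  have hRz : R z₀ = 0 := hψ0
  obtain ⟨ε, hε, hball⟩ := Metric.isOpen_iff.1 R.open_target 0 (hRz ▸ R.map_source hR0)
  have hRsrc : R.source ⊆ W := fun z hz => hz.2
  -- If |α - α₀| < ε^k, every k-th root of α - α₀ has modulus below ε and so lies in the ball on
  -- which the inverse of ψ is defined.
  refine ⟨R.source ∩ R ⁻¹' Metric.ball 0 ε, R.isOpen_inter_preimage Metric.isOpen_ball,
    ⟨hR0, by simp [hRz, hε]⟩, fun z hz => (hW (hRsrc hz.1)).1, Metric.ball α₀ (ε ^ k),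
    Metric.ball_mem_nhds _ (by positivity),
    (fun (ζ : ℂ) (α : ℝ) => R.symm (ζ * ρ (α - α₀))) '' {ζ | ζ ^ k = 1}, ?_, ?_, ?_⟩
  · refine Finite.image _ ?_
    refine (Multiset.finite_toSet (Polynomial.nthRoots k (1 : ℂ))).subset fun ζ hζ => ?_
    exact (Polynomial.mem_nthRoots (Nat.pos_of_ne_zero hk)).2 hζ
  all_goals
    have hsmall : ∀ ζ : ℂ, ζ ^ k = 1 → ∀ α ∈ Metric.ball α₀ (ε ^ k),
        ζ * ρ (α - α₀) ∈ Metric.ball (0 : ℂ) ε := by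
      intro ζ hζ α hα
      rw [mem_ball_zero_iff]
      refine lt_of_pow_lt_pow_left₀ k hε.le ?_
      rw [← norm_pow, mul_pow, hζ, one_mul, hρk, Complex.norm_real, ← dist_eq_norm]
      exact hα
  · rintro _ ⟨ζ, hζ, rfl⟩
    refine R.continuousOn_symm.comp ((continuous_const.mul
      (hρ.comp (continuous_id.sub continuous_const))).continuousOn) ?_
    intro α hα
    exact hball (hsmall ζ hζ α hα)
  · intro α hα μ
    have hiff : ∀ z ∈ W, (f z + α * g z = 0 ↔ ψ z ^ k = ((α - α₀ : ℝ) : ℂ)) := by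
      intro z hz
      obtain ⟨-, hz2, hz3⟩ := hW hz
      have hz2' : g z ≠ 0 := hz2
      have hz3' : h z = ψ z ^ k := hz3
      have : f z + α * g z = g z * (((α - α₀ : ℝ) : ℂ) - ψ z ^ k) := by
        rw [← hz3', hh]
        push_cast
        field_simp
        ring
      rw [this, mul_eq_zero, or_iff_right hz2', sub_eq_zero, eq_comm]
    constructor
    · rintro ⟨⟨hμ1, hμ2⟩, hμ3⟩
      have hk1 := (hiff μ (hRsrc hμ1)).1 hμ3
      -- At α = α₀ all roots of unity give the same point. Otherwise ζ = ψ(μ)/ρ(α - α₀) is the one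
      -- to take.
      rcases eq_or_ne (ρ (α - α₀)) 0 with h | h
      · refine ⟨_, ⟨1, one_pow k, rfl⟩, ?_⟩
        have h1 := hρk (α - α₀)
        rw [h, zero_pow hk] at h1
        rw [← h1] at hk1
        have : R μ = 0 := eq_zero_of_pow_eq_zero hk1
        change R.symm (1 * ρ (α - α₀)) = μ
        rw [h, mul_zero, ← this, R.left_inv hμ1]
      · refine ⟨_, ⟨ψ μ / ρ (α - α₀), ?_, rfl⟩, ?_⟩
        · change (ψ μ / ρ (α - α₀)) ^ k = 1
          rw [div_pow, hk1, ← hρk, div_self (pow_ne_zero k h)]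
        · change R.symm (ψ μ / ρ (α - α₀) * ρ (α - α₀)) = μ
          rw [div_mul_cancel₀ _ h, ← hRψ, R.left_inv hμ1]
    · rintro ⟨_, ⟨ζ, hζ, rfl⟩, rfl⟩
      have hb := hsmall ζ hζ α hα
      have hs : R.symm (ζ * ρ (α - α₀)) ∈ R.source := R.map_target (hball hb)
      have hr : R (R.symm (ζ * ρ (α - α₀))) = ζ * ρ (α - α₀) := R.right_inv (hball hb)
      refine ⟨⟨hs, ?_⟩, ?_⟩
      · rw [mem_preimage, hr]; exact hb
      · rw [hiff _ (hRsrc hs), ← hRψ, hr, mul_pow, show ζ ^ k = 1 from hζ, one_mul, hρk]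

/-- The zeros in K at a fixed α₀ form a compact set covered by finitely many local pictures, and
these exhaust the zeros for α near α₀. A subdivision of [0, T] then reduces the claim to gluing. The
point z₁ excludes that f + α g vanishes identically. -/
theorem hasBranches_Icc {f g : ℂ → ℂ} (hf : Differentiable ℂ f) (hg : Differentiable ℂ g)
    (hfg : ∀ z, f z = 0 → g z ≠ 0) {z₁ : ℂ} (hf1 : f z₁ ≠ 0) (hg1 : g z₁ = 0)
    {Ω K : Set ℂ} (hΩ : IsOpen Ω) (hK : IsCompact K) (hΩK : Ω ⊆ K) {T : ℝ} (hT : 0 ≤ T)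
    (hKΩ : ∀ α ∈ Icc 0 T, ∀ z ∈ K, f z + α * g z = 0 → z ∈ Ω) :
    HasBranches f g Ω (Icc 0 T) := by
  have hlocal : ∀ α₀ : Icc 0 T, ∃ N ∈ 𝓝 (α₀ : ℝ), HasBranches f g Ω (N ∩ Icc 0 T) := by
    rintro ⟨α₀, hα₀⟩
    have hcont : Continuous fun p : ℝ × ℂ => f p.2 + p.1 * g p.2 := by
      have := hf.continuous
      have := hg.continuous
      fun_prop
    have hne : ∀ z, ¬ ∀ᶠ y in 𝓝 z, f y + α₀ * g y = 0 := by
      intro z H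
      have hd : Differentiable ℂ fun y => f y + α₀ * g y := by fun_prop
      have := AnalyticOnNhd.eq_of_eventuallyEq (f := fun y => f y + α₀ * g y) (g := 0)
        (fun y _ => hd.analyticAt y) (fun y _ => analyticAt_const) H
      have h2 := congrFun this z₁
      simp only [hg1, mul_zero, add_zero, Pi.zero_apply] at h2
      exact hf1 h2
    set Z : Set ℂ := K ∩ {z | f z + α₀ * g z = 0} with hZ
    have hZc : IsCompact Z := hK.inter_right
      (isClosed_eq (hcont.comp (Continuous.prodMk_right α₀)) continuous_const)
    have hloc : ∀ z ∈ Z, ∃ U : Set ℂ, IsOpen U ∧ z ∈ U ∧ U ⊆ Ω ∧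
        ∃ N ∈ 𝓝 α₀, HasBranches f g U N := by
      intro z hz
      have hgz : g z ≠ 0 := by
        intro hg0
        have h1 : f z + α₀ * g z = 0 := hz.2
        rw [hg0, mul_zero, add_zero] at h1
        exact hfg z h1 hg0
      exact exists_local_hasBranches hf hg hz.2 hgz (hne z)
        (hΩ.mem_nhds (hKΩ α₀ hα₀ z hz.1 hz.2))
    choose! U hUo hzU hUΩ N hN hB using hloc
    obtain ⟨t, htZ, hcov⟩ := hZc.elim_nhds_subcover U fun z hz => (hUo z hz).mem_nhds (hzU z hz)
    choose! G hGf hGc hGi using hB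
    have hUt : IsOpen (⋃ z ∈ t, U z) := isOpen_biUnion fun z hz => hUo z (htZ z hz)
    -- Tube argument: no zero at α₀ lies in the compact set left uncovered, hence none does for
    -- nearby α.
    have htube : ∀ᶠ α : ℝ in 𝓝 α₀, ∀ z ∈ K \ ⋃ z ∈ t, U z, f z + α * g z ≠ 0 := by
      refine (hK.diff hUt).eventually_forall_of_forall_eventually fun z hz => ?_
      refine hcont.continuousAt.eventually_ne ?_
      intro h0
      exact hz.2 (hcov ⟨hz.1, h0⟩)
    have hNt : (⋂ z ∈ t, N z) ∈ 𝓝 α₀ := (Filter.biInter_finset_mem t).2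
      fun z hz => hN z (htZ z hz)
    refine ⟨_, inter_mem htube hNt, ⋃ z ∈ t, G z, ?_, ?_, ?_⟩
    · exact t.finite_toSet.biUnion fun z hz => hGf z (htZ z hz)
    · intro γ hγ
      obtain ⟨z, hz, hγz⟩ := mem_iUnion₂.1 hγ
      exact (hGc z (htZ z hz) γ hγz).mono fun α hα => mem_iInter₂.1 hα.1.2 z hz
    · rintro α ⟨⟨hα1, hα2⟩, hα3⟩ μ
      constructor
      · rintro ⟨hμ1, hμ2⟩
        have hμU : μ ∈ ⋃ z ∈ t, U z := by
          by_contra hcon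
          exact hα1 μ ⟨hΩK hμ1, hcon⟩ hμ2
        obtain ⟨z, hz, hμz⟩ := mem_iUnion₂.1 hμU
        obtain ⟨γ, hγ, he⟩ := (hGi z (htZ z hz) α (mem_iInter₂.1 hα2 z hz) μ).1 ⟨hμz, hμ2⟩
        exact ⟨γ, mem_iUnion₂.2 ⟨z, hz, hγ⟩, he⟩
      · rintro ⟨γ, hγ, he⟩
        obtain ⟨z, hz, hγz⟩ := mem_iUnion₂.1 hγ
        obtain ⟨h1, h2⟩ := (hGi z (htZ z hz) α (mem_iInter₂.1 hα2 z hz) μ).2 ⟨γ, hγz, he⟩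
        exact ⟨hUΩ z (htZ z hz) h1, h2⟩
  choose N hN hNB using hlocal
  -- A Lebesgue-number subdivision: a monotone sequence from 0 that becomes constantly T, each step
  -- inside one of the good neighbourhoods.
  obtain ⟨t, ht0, htm, ⟨m, hm⟩, hts⟩ := exists_monotone_Icc_subset_open_cover_Icc hT
    (c := fun α₀ : Icc 0 T => (Subtype.val ⁻¹' interior (N α₀) : Set (Icc 0 T)))
    (fun α₀ => isOpen_interior.preimage continuous_subtype_val)
    (fun α₀ _ => mem_iUnion.2 ⟨α₀, mem_interior_iff_mem_nhds.2 (hN α₀)⟩)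
  have hstep : ∀ n, HasBranches f g Ω (Icc (t n : ℝ) (t (n + 1))) := by
    intro n
    obtain ⟨i, hi⟩ := hts n
    refine (hNB i).mono fun α hα => ?_
    have hα' : α ∈ Icc 0 T := ⟨(t n).2.1.trans hα.1, hα.2.trans (t (n + 1)).2.2⟩
    exact ⟨interior_subset (hi (show (⟨α, hα'⟩ : Icc 0 T) ∈ Icc (t n) (t (n + 1)) from hα)), hα'⟩
  have hall : ∀ n, HasBranches f g Ω (Icc 0 (t (n + 1) : ℝ)) := by
    intro n
    induction n with
    | zero =>
      have := hstep 0
      rwa [ht0] at this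
    | succ n ih => exact ih.glue (t (n + 1)).2.1 (htm (Nat.le_succ _)) (hstep (n + 1))
  have := hall m
  rwa [hm (m + 1) (Nat.le_succ m)] at this

/-! ### Lower bounds on the separating circles -/

theorem norm_sinh_le (z : ℂ) : ‖Complex.sinh z‖ ≤ Real.exp |z.re| := by
  have h : Complex.sinh z = (Complex.exp z - Complex.exp (-z)) / 2 := rfl
  rw [h, norm_div, Complex.norm_ofNat, div_le_iff₀ two_pos]
  calc ‖Complex.exp z - Complex.exp (-z)‖ ≤ ‖Complex.exp z‖ + ‖Complex.exp (-z)‖ :=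
        norm_sub_le _ _
    _ ≤ Real.exp |z.re| + Real.exp |z.re| := by
        rw [Complex.norm_exp, Complex.norm_exp, Complex.neg_re]
        exact add_le_add (Real.exp_le_exp.2 (le_abs_self _)) (Real.exp_le_exp.2 (neg_le_abs _))
    _ = _ := by ring

theorem norm_sinh_eq (z : ℂ) : ‖Complex.sinh z‖ = ‖Complex.sin (z * Complex.I)‖ := by
  rw [Complex.sin_mul_I, norm_mul, Complex.norm_I, mul_one]

theorem norm_sin_le (z : ℂ) : ‖Complex.sin z‖ ≤ Real.exp |z.im| := by
  have h := norm_sinh_le (z * -Complex.I)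
  rw [norm_sinh_eq, mul_assoc, neg_mul, Complex.I_mul_I, neg_neg, mul_one] at h
  simpa using h

theorem norm_sin_sq (z : ℂ) :
    ‖Complex.sin z‖ ^ 2 = Real.sin z.re ^ 2 + Real.sinh z.im ^ 2 := by
  rw [Complex.sq_norm, Complex.sin_eq, ← Complex.ofReal_sin, ← Complex.ofReal_cosh,
    ← Complex.ofReal_cos, ← Complex.ofReal_sinh, ← Complex.ofReal_mul, ← Complex.ofReal_mul,
    Complex.normSq_add_mul_I]
  have h1 := Real.cosh_sq z.im
  have h2 := Real.sin_sq_add_cos_sq z.re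
  rw [mul_pow, mul_pow, h1]
  linear_combination Real.sinh z.im ^ 2 * h2

/-- Away from the real axis |sin z| ≥ sinh |Im z|, comparable to the exponential. Near the axis, a
point of this circle has real part close to ±(n + 1/2)π, where |sin| is close to 1. -/
theorem exp_le_norm_sin {n : ℕ} (hn : 1 ≤ n) {z : ℂ} (hz : ‖z‖ = (n + 1 / 2) * Real.pi) :
    Real.exp |z.im| / 8 ≤ ‖Complex.sin z‖ := by
  have hsq := norm_sin_sq z
  rcases le_total 1 |z.im| with h | h
  · have h1 : Real.sinh |z.im| ≤ ‖Complex.sin z‖ := by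
      refine le_of_abs_le (abs_le_of_sq_le_sq ?_ (norm_nonneg _))
      rw [hsq, ← Real.abs_sinh, sq_abs]
      nlinarith [sq_nonneg (Real.sin z.re)]
    have h2 : Real.sinh |z.im| = (Real.exp |z.im| - Real.exp (-|z.im|)) / 2 := Real.sinh_eq _
    have h3 := Real.add_one_le_exp |z.im|
    have h4 : Real.exp (-|z.im|) ≤ 1 := Real.exp_le_one_iff.2 (by linarith)
    linarith
  · have h1 : |Real.sin z.re| ≤ ‖Complex.sin z‖ := by
      refine le_of_abs_le (abs_le_of_sq_le_sq ?_ (norm_nonneg _))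
      rw [hsq, sq_abs]
      nlinarith [sq_nonneg (Real.sinh z.im)]
    have hr : 4 ≤ ‖z‖ := by
      rw [hz]
      have : (1 : ℝ) ≤ n := by exact_mod_cast hn
      nlinarith [Real.pi_gt_three]
    have hd : ‖z‖ ^ 2 = |z.re| ^ 2 + |z.im| ^ 2 := by
      rw [Complex.sq_norm, Complex.normSq_apply, sq_abs, sq_abs]; ring
    have hx : |z.re| ≤ ‖z‖ := Complex.abs_re_le_norm z
    -- Here (|z| - |Re z|)(|z| + |Re z|) = |Im z|² ≤ 1, while |z| ≥ 4.
    have hd1 : ‖z‖ - |z.re| ≤ 1 / 2 := by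
      nlinarith [abs_nonneg z.re, abs_nonneg z.im]
    have h2 : |Real.sin z.re| = |Real.cos (‖z‖ - |z.re|)| := by
      have hc : Real.cos ‖z‖ = 0 := by
        rw [Real.cos_eq_zero_iff]
        exact ⟨n, by rw [hz]; push_cast; ring⟩
      have hs : |Real.sin ‖z‖| = 1 := by
        have := Real.sin_sq_add_cos_sq ‖z‖
        rw [hc] at this
        rw [← sq_eq_sq₀ (abs_nonneg _) zero_le_one, sq_abs]
        linarith
      rw [Real.cos_sub, hc, zero_mul, zero_add, abs_mul, hs, one_mul]
      rcases abs_choice z.re with h | h <;> rw [h]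
      rw [Real.sin_neg, abs_neg]
    have h3 := Real.one_sub_sq_div_two_le_cos (x := ‖z‖ - |z.re|)
    have h4 : 1 / 2 ≤ |Real.sin z.re| := by
      rw [h2]
      refine le_trans ?_ (le_abs_self _)
      nlinarith
    have h5 : Real.exp |z.im| ≤ 3 :=
      (Real.exp_le_exp.2 h).trans Real.exp_one_lt_three.le
    linarith

theorem exists_pow_four (w : ℂ) : ∃ l : ℂ, l ^ 4 = w :=
  ⟨w ^ ((4 : ℕ) : ℂ)⁻¹, Complex.cpow_nat_inv_pow w four_ne_zero⟩

/-- Multiply the equation by 2λ⁵. The free term 2λ³ sin λ sinh λ is at least 2|λ|³ e^(|Re λ| + |Im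
λ|)/64. The load term is at most 2|κ| times the same exponential, because the lengths ξ and 1 - ξ
add up to 1. A zero would force |λ|³ ≤ 64|κ|. -/
theorem char_ne_zero_of_norm {ξ : ℝ} (h0 : 0 ≤ ξ) (h1 : ξ ≤ 1) {n : ℕ} (hn : 1 ≤ n) {w κ : ℂ}
    (hw : ‖w‖ = ((n + 1 / 2) * Real.pi) ^ 4) (hκ : 64 * ‖κ‖ < ((n + 1 / 2) * Real.pi) ^ 3) :
    charS w + κ * charT ξ w ≠ 0 := by
  intro hF
  obtain ⟨l, rfl⟩ := exists_pow_four w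
  have hr0 : 0 < (n + 1 / 2) * Real.pi := by positivity
  have hl : ‖l‖ = (n + 1 / 2) * Real.pi := by
    rw [norm_pow] at hw
    exact (pow_left_inj₀ (norm_nonneg _) hr0.le four_ne_zero).1 hw
  have hS := sq_mul_charS l
  have hT := pow_five_mul_charT ξ l
  have e1 : 2 * l ^ 3 * (Complex.sin l * Complex.sinh l) = -(κ * (Complex.sin (l * (1 - ξ)) *
      Complex.sin (l * ξ) * Complex.sinh l -
      Complex.sinh (l * (1 - ξ)) * Complex.sinh (l * ξ) * Complex.sin l)) := by
    rw [← hS, ← hT]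
    linear_combination 2 * l ^ 5 * hF
  have s1 := exp_le_norm_sin hn hl
  have s2 := exp_le_norm_sin hn (z := l * Complex.I) (by simpa using hl)
  rw [← norm_sinh_eq] at s2
  simp only [Complex.mul_I_im] at s2
  set X := |l.re| with hX
  set Y := |l.im| with hY
  have hre : ∀ t : ℝ, (l * t).re = l.re * t := fun t => by simp
  have him : ∀ t : ℝ, (l * t).im = l.im * t := fun t => by simp
  have hcast : (1 - ξ : ℂ) = ((1 - ξ : ℝ) : ℂ) := by push_cast; ring
  have u1 : ∀ t : ℝ, 0 ≤ t → ‖Complex.sin (l * t)‖ ≤ Real.exp (Y * t) := by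
    intro t ht
    have := norm_sin_le (l * t)
    rwa [him, abs_mul, abs_of_nonneg ht] at this
  have u2 : ∀ t : ℝ, 0 ≤ t → ‖Complex.sinh (l * t)‖ ≤ Real.exp (X * t) := by
    intro t ht
    have := norm_sinh_le (l * t)
    rwa [hre, abs_mul, abs_of_nonneg ht] at this
  have v1 : ‖Complex.sin (l * (1 - ξ))‖ * ‖Complex.sin (l * ξ)‖ * ‖Complex.sinh l‖ ≤
      Real.exp Y * Real.exp X := by
    have := norm_sinh_le l
    have e : Real.exp Y = Real.exp (Y * (1 - ξ)) * Real.exp (Y * ξ) := by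
      rw [← Real.exp_add]; ring_nf
    rw [e, hcast]
    gcongr
    exacts [u1 _ (by linarith), u1 _ h0]
  have v2 : ‖Complex.sinh (l * (1 - ξ))‖ * ‖Complex.sinh (l * ξ)‖ * ‖Complex.sin l‖ ≤
      Real.exp X * Real.exp Y := by
    have := norm_sin_le l
    have e : Real.exp X = Real.exp (X * (1 - ξ)) * Real.exp (X * ξ) := by
      rw [← Real.exp_add]; ring_nf
    rw [e, hcast]
    gcongr
    exacts [u2 _ (by linarith), u2 _ h0]
  have w1 : 2 * ‖l‖ ^ 3 * (Real.exp Y / 8 * (Real.exp X / 8)) ≤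
      ‖κ‖ * (Real.exp Y * Real.exp X + Real.exp X * Real.exp Y) := by
    calc 2 * ‖l‖ ^ 3 * (Real.exp Y / 8 * (Real.exp X / 8))
        ≤ 2 * ‖l‖ ^ 3 * (‖Complex.sin l‖ * ‖Complex.sinh l‖) := by gcongr
      _ = ‖2 * l ^ 3 * (Complex.sin l * Complex.sinh l)‖ := by simp
      _ ≤ ‖κ‖ * (‖Complex.sin (l * (1 - ξ))‖ * ‖Complex.sin (l * ξ)‖ * ‖Complex.sinh l‖ +
          ‖Complex.sinh (l * (1 - ξ))‖ * ‖Complex.sinh (l * ξ)‖ * ‖Complex.sin l‖) := by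
        rw [e1, norm_neg, norm_mul]
        gcongr
        refine (norm_sub_le _ _).trans ?_
        simp only [norm_mul]
        rfl
      _ ≤ _ := by gcongr
  have hE : 0 < Real.exp Y * Real.exp X := by positivity
  rw [← hl] at hκ
  nlinarith

/-- The fourth power of the frequency which belongs to the eigenvalue `μ`. -/
def freq (a b : ℝ) (μ : ℂ) : ℂ := -((b : ℂ) * μ + μ ^ 2) / (a : ℂ)

theorem mul_freq {a : ℝ} (ha : a ≠ 0) (b : ℝ) (μ : ℂ) :
    (a : ℂ) * freq a b μ = -(b * μ + μ ^ 2) :=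
  mul_div_cancel₀ _ (Complex.ofReal_ne_zero.2 ha)

/-- Since |μ||μ + b| = a|w| ≤ a r⁴, the two factors cannot both exceed (a + 1) r². Thus μ grows at
most like |w|^(1/2). -/
theorem norm_le_of_norm_freq_le {a b : ℝ} (ha : 0 < a) (hb : 0 ≤ b) {μ : ℂ} {r : ℝ} (hr : 0 ≤ r)
    (h : ‖freq a b μ‖ ≤ r ^ 4) : ‖μ‖ ≤ b + (a + 1) * r ^ 2 := by
  by_contra! hcon
  have h1 : ‖μ + b‖ ≥ ‖μ‖ - b := by
    have := norm_sub_le (μ + b) (b : ℂ)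
    rw [add_sub_cancel_right, Complex.norm_real, Real.norm_of_nonneg hb] at this
    linarith
  have h2 : ‖μ‖ * ‖μ + b‖ ≤ a * r ^ 4 := by
    have : ‖(a : ℂ) * freq a b μ‖ = ‖μ‖ * ‖μ + b‖ := by
      rw [mul_freq ha.ne', norm_neg, ← norm_mul]; ring_nf
    rw [← this, norm_mul, Complex.norm_real, Real.norm_of_nonneg ha.le]
    gcongr
  have h3 : (a + 1) * r ^ 2 < ‖μ + b‖ := by linarith
  have h4 : (a + 1) * r ^ 2 < ‖μ‖ := by linarith
  have h5 : 0 ≤ (a + 1) * r ^ 2 := by positivity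
  have h6 := mul_lt_mul'' h4 h3 h5 h5
  nlinarith [pow_nonneg hr 4, mul_nonneg ha.le (pow_nonneg hr 4)]

theorem norm_freq_le {a b : ℝ} (ha : 0 < a) (hb : 0 ≤ b) {μ : ℂ} {R : ℝ} (h : ‖μ‖ ≤ R) :
    ‖freq a b μ‖ ≤ (b * R + R ^ 2) / a := by
  rw [freq, norm_div, norm_neg, Complex.norm_real, Real.norm_of_nonneg ha.le]
  gcongr
  refine (norm_add_le _ _).trans ?_
  rw [norm_mul, norm_pow, Complex.norm_real, Real.norm_of_nonneg hb]
  gcongr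

theorem continuous_freq (a b : ℝ) : Continuous (freq a b) := by
  unfold freq
  fun_prop

/-- The radii of the circles which separate the eigenvalues. -/
def radius (n : ℕ) : ℝ := (n + 1 / 2) * Real.pi

theorem radius_pos (n : ℕ) : 0 < radius n := by unfold radius; positivity

theorem natCast_le_radius (n : ℕ) : (n : ℝ) ≤ radius n := by
  unfold radius
  nlinarith [Real.pi_gt_three, Nat.cast_nonneg (α := ℝ) n]

/-- On the circle |w| = r⁴ the load coefficient (α/a)μ is O(r²), uniformly for α in [0, T], and is
eventually beaten by the r³ of `char_ne_zero_of_norm`. -/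
theorem exists_char_ne_zero {a b : ℝ} (ha : 0 < a) (hb : 0 ≤ b) {ξ : ℝ} (h0 : 0 ≤ ξ)
    (h1 : ξ ≤ 1) (T : ℝ) : ∃ N : ℕ, ∀ n ≥ N, ∀ α ∈ Icc 0 T, ∀ μ : ℂ,
      ‖freq a b μ‖ = radius n ^ 4 →
      charS (freq a b μ) + (α / a : ℝ) * μ * charT ξ (freq a b μ) ≠ 0 := by
  obtain ⟨N, hN⟩ := exists_nat_gt (64 * (T / a * (a + b + 1)))
  refine ⟨N + 1, fun n hn α hα μ hμ => ?_⟩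
  refine char_ne_zero_of_norm h0 h1 (le_trans (Nat.le_add_left 1 N) hn) hμ ?_
  change _ < radius n ^ 3
  have hr : (n : ℝ) ≤ radius n := natCast_le_radius n
  have hn1 : (N : ℝ) + 1 ≤ n := by exact_mod_cast hn
  have hr1 : 1 ≤ radius n := by
    have := Nat.cast_nonneg (α := ℝ) N
    linarith
  have hm := norm_le_of_norm_freq_le ha hb (radius_pos n).le hμ.le
  have hm2 : ‖μ‖ ≤ (a + b + 1) * radius n ^ 2 := by
    nlinarith [one_le_pow₀ (n := 2) hr1]
  have hT : 0 ≤ T := hα.1.trans hα.2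
  have hκ : ‖((α / a : ℝ) : ℂ) * μ‖ ≤ T / a * ((a + b + 1) * radius n ^ 2) := by
    rw [norm_mul, Complex.norm_real, Real.norm_of_nonneg (div_nonneg hα.1 ha.le)]
    gcongr
    exact hα.2
  have hlt : 64 * (T / a * (a + b + 1)) < radius n := by linarith
  calc 64 * ‖((α / a : ℝ) : ℂ) * μ‖ ≤ 64 * (T / a * (a + b + 1)) * radius n ^ 2 := by
        linarith
    _ < radius n * radius n ^ 2 := by
        have := radius_pos n
        gcongr
    _ = radius n ^ 3 := by ring

/-! ### The spectrum at α = 0 and nondegeneracy of the load term -/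

theorem sin_nat_mul_pi_mul_ne_zero {η : ℝ} (hη : Irrational η) {n : ℕ} (hn : 1 ≤ n) :
    Complex.sin (n * Real.pi * η) ≠ 0 := by
  intro h
  obtain ⟨k, hk⟩ := Complex.sin_eq_zero_iff.1 h
  have hk' : (n : ℝ) * Real.pi * η = k * Real.pi := by exact_mod_cast hk
  have hk2 : (n : ℝ) * η = k := by
    apply mul_right_cancel₀ Real.pi_ne_zero
    linarith
  have := hη.natCast_mul (Nat.one_le_iff_ne_zero.1 hn)
  exact this.ne_int k hk2

theorem sinh_nat_mul_pi_ne_zero {n : ℕ} (hn : 1 ≤ n) : Complex.sinh (n * Real.pi) ≠ 0 := by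
  have h : (0 : ℝ) < n * Real.pi := mul_pos (by exact_mod_cast hn) Real.pi_pos
  have := (Real.sinh_pos_iff.2 h).ne'
  exact_mod_cast this

theorem sin_nat_mul_pi_complex (n : ℕ) : Complex.sin (n * Real.pi) = 0 :=
  Complex.sin_nat_mul_pi n

/-- Zeros of sin and sinh lie at kπ and ikπ, and both have fourth power (kπ)⁴. The value k = 0 is
spurious: S(0) = 1, as the division by λ² removes that zero. -/
theorem charS_eq_zero_iff (w : ℂ) :
    charS w = 0 ↔ ∃ n : ℕ, 1 ≤ n ∧ w = ((n : ℂ) * Real.pi) ^ 4 := by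
  constructor
  · intro h
    obtain ⟨l, rfl⟩ := exists_pow_four w
    have hl : l ≠ 0 := by
      rintro rfl
      rw [zero_pow four_ne_zero, charS_zero] at h
      exact one_ne_zero h
    have hS := sq_mul_charS l
    rw [h, mul_zero] at hS
    obtain ⟨k, hk⟩ : ∃ k : ℤ, l ^ 4 = (k * Real.pi) ^ 4 := by
      rcases mul_eq_zero.1 hS.symm with h1 | h1
      · obtain ⟨k, hk⟩ := Complex.sin_eq_zero_iff.1 h1
        exact ⟨k, by rw [hk]⟩
      · have h2 : Complex.sin (l * Complex.I) = 0 := by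
          rw [Complex.sin_mul_I, h1, zero_mul]
        obtain ⟨k, hk⟩ := Complex.sin_eq_zero_iff.1 h2
        exact ⟨k, by rw [← hk, mul_pow, Complex.I_pow_four, mul_one]⟩
    have hk0 : k ≠ 0 := by
      rintro rfl
      simp [hl] at hk
    refine ⟨k.natAbs, Int.natAbs_pos.2 hk0, ?_⟩
    have h4 : ((k.natAbs : ℕ) : ℤ) ^ 4 = k ^ 4 := by
      rw [Int.natCast_natAbs, Even.pow_abs (by decide)]
    have h5 : ((k.natAbs : ℕ) : ℂ) ^ 4 = (k : ℂ) ^ 4 := by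
      simpa only [Int.cast_pow, Int.cast_natCast] using congrArg (Int.cast : ℤ → ℂ) h4
    rw [hk, mul_pow, mul_pow, h5]
  · rintro ⟨n, hn, rfl⟩
    have hS := sq_mul_charS (n * Real.pi)
    rw [sin_nat_mul_pi_complex, zero_mul] at hS
    refine (mul_eq_zero.1 hS).resolve_left (pow_ne_zero 2 ?_)
    exact mul_ne_zero (Nat.cast_ne_zero.2 (Nat.one_le_iff_ne_zero.1 hn))
      (Complex.ofReal_ne_zero.2 Real.pi_ne_zero)

/-- At λ = nπ only sin(λ(1 - ξ)) sin(λξ) sinh λ survives, and no factor vanishes for irrational ξ.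
-/
theorem charT_ne_zero {ξ : ℝ} (hξ : Irrational ξ) {n : ℕ} (hn : 1 ≤ n) :
    charT ξ (((n : ℂ) * Real.pi) ^ 4) ≠ 0 := by
  intro h
  have hT := pow_five_mul_charT ξ (n * Real.pi)
  rw [h, mul_zero, sin_nat_mul_pi_complex, mul_zero, sub_zero] at hT
  have h1 : Irrational (1 - ξ) := by simpa using hξ.ratCast_sub 1
  have h2 := sin_nat_mul_pi_mul_ne_zero h1 hn
  push_cast at h2
  exact mul_ne_zero (mul_ne_zero h2 (sin_nat_mul_pi_mul_ne_zero hξ hn))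
    (sinh_nat_mul_pi_ne_zero hn) hT.symm

/-- Removes the case distinction on the sign of the discriminant: in either case D is one of its
complex square roots. -/
theorem exists_muZero_eq (a b : ℝ) (n : ℕ) :
    ∃ D : ℂ, D ^ 2 = b ^ 2 - 4 * a * ((n : ℂ) * Real.pi) ^ 4 ∧
      ∀ s : ℤˣ, muZero a b n s = (1 / 2) * (-(b : ℂ) + ((s : ℤ) : ℂ) * D) := by
  unfold muZero
  split_ifs with h
  · refine ⟨_, ?_, fun s => rfl⟩
    rw [← Complex.ofReal_pow, Real.sq_sqrt (by linarith)]
    push_cast; ring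
  · refine ⟨_, ?_, fun s => rfl⟩
    rw [mul_pow, Complex.I_sq, ← Complex.ofReal_pow, Real.sq_sqrt (by linarith)]
    push_cast; ring

theorem freq_eq_iff {a : ℝ} (ha : a ≠ 0) (b : ℝ) (n : ℕ) (μ : ℂ) :
    freq a b μ = ((n : ℂ) * Real.pi) ^ 4 ↔ ∃ s : ℤˣ, μ = muZero a b n s := by
  obtain ⟨D, hD, hs⟩ := exists_muZero_eq a b n
  have ha' : (a : ℂ) ≠ 0 := Complex.ofReal_ne_zero.2 ha
  have h1 : freq a b μ = ((n : ℂ) * Real.pi) ^ 4 ↔ (2 * μ + b) ^ 2 = D ^ 2 := by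
    rw [hD, freq, div_eq_iff ha']
    constructor <;> intro h
    · linear_combination -4 * h
    · linear_combination -h / 4
  rw [h1, sq_eq_sq_iff_eq_or_eq_neg]
  constructor
  · rintro (h | h)
    · exact ⟨1, by rw [hs]; push_cast; linear_combination h / 2⟩
    · exact ⟨-1, by rw [hs]; push_cast; linear_combination h / 2⟩
  · rintro ⟨s, rfl⟩
    rw [hs]
    rcases Int.units_eq_one_or s with rfl | rfl
    · left; push_cast; ring
    · right; push_cast; ring

theorem charS_freq_eq_zero_iff {a : ℝ} (ha : a ≠ 0) (b : ℝ) (μ : ℂ) :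
    charS (freq a b μ) = 0 ↔ ∃ n : ℕ, 1 ≤ n ∧ ∃ s : ℤˣ, μ = muZero a b n s := by
  rw [charS_eq_zero_iff]
  exact exists_congr fun n => and_congr_right fun _ => freq_eq_iff ha b n μ

/-- The part of the characteristic function which is linear in `α`. -/
def charG (a b ξ : ℝ) (μ : ℂ) : ℂ := μ * charT ξ (freq a b μ) / a

theorem isEigenvalue_iff_char {a : ℝ} (ha : a ≠ 0) (b α : ℝ) (ξ : Ioo (0 : ℝ) 1) (μ : ℂ) :
    IsEigenvalue (Beam.A a b α ξ) μ ↔ charS (freq a b μ) + α * charG a b ξ μ = 0 := by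
  rw [isEigenvalue_iff ha ξ (mul_freq ha b μ), charG]
  push_cast
  rw [show (α : ℂ) / a * μ * charT ξ (freq a b μ) = α * (μ * charT ξ (freq a b μ) / a) by ring]

theorem differentiable_freq (a b : ℝ) : Differentiable ℂ (freq a b) := by
  unfold freq
  fun_prop

theorem differentiable_charS_freq (a b : ℝ) : Differentiable ℂ fun μ => charS (freq a b μ) :=
  differentiable_charS.comp (differentiable_freq a b)

theorem differentiable_charG (a b ξ : ℝ) : Differentiable ℂ (charG a b ξ) :=
  (differentiable_id.mul ((differentiable_charT ξ).comp (differentiable_freq a b))).div_const _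

theorem freq_zero (a b : ℝ) : freq a b 0 = 0 := by simp [freq]

theorem charG_ne_zero {a : ℝ} (ha : a ≠ 0) (b : ℝ) {ξ : ℝ} (hξ : Irrational ξ) {μ : ℂ}
    (h : charS (freq a b μ) = 0) : charG a b ξ μ ≠ 0 := by
  obtain ⟨n, hn, hw⟩ := (charS_eq_zero_iff _).1 h
  refine div_ne_zero (mul_ne_zero ?_ ?_) (Complex.ofReal_ne_zero.2 ha)
  · rintro rfl
    rw [freq_zero, charS_zero] at h
    exact one_ne_zero h
  · rw [hw]
    exact charT_ne_zero hξ hn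

/-! ### Global branches of eigenvalues -/

theorem exists_forall_char_ne_zero {a b : ℝ} (ha : 0 < a) (hb : 0 ≤ b) (ξ : Ioo (0 : ℝ) 1)
    (T : ℝ) : ∃ N : ℕ, ∀ n ≥ N, ∀ α ∈ Icc 0 T, ∀ μ : ℂ,
      charS (freq a b μ) + α * charG a b ξ μ = 0 → ‖freq a b μ‖ ≠ radius n ^ 4 := by
  obtain ⟨N, hN⟩ := exists_char_ne_zero ha hb ξ.2.1.le ξ.2.2.le T
  refine ⟨N, fun n hn α hα μ h h1 => hN n hn α hα μ h1 ?_⟩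
  rw [← h, charG]
  push_cast
  ring

theorem isCompact_freq_le {a b : ℝ} (ha : 0 < a) (hb : 0 ≤ b) (n : ℕ) :
    IsCompact {μ : ℂ | ‖freq a b μ‖ ≤ radius n ^ 4} := by
  refine (isCompact_closedBall (0 : ℂ) (b + (a + 1) * radius n ^ 2)).of_isClosed_subset
    (isClosed_le (continuous_freq a b).norm continuous_const) fun μ hμ => ?_
  rw [mem_closedBall_zero_iff]
  exact norm_le_of_norm_freq_le ha hb (radius_pos n).le hμ

theorem natCast_le_radius_pow (n : ℕ) : (n : ℝ) ≤ radius n ^ 4 := by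
  have h := natCast_le_radius n
  have h1 : 1 ≤ radius n := by
    unfold radius
    nlinarith [Real.pi_gt_three, Nat.cast_nonneg (α := ℝ) n]
  exact h.trans (le_self_pow₀ h1 four_ne_zero)

/-- No zero crosses a circle |w| = `radius n` ^ 4 with n ≥ N, so each annulus between consecutive
circles can be treated alone by `hasBranches_Icc`. The annuli escape to infinity, which gives the
local finiteness. -/
theorem exists_branches {a b : ℝ} (ha : 0 < a) (hb : 0 ≤ b) (ξ : Ioo (0 : ℝ) 1)
    (hξ : Irrational (ξ : ℝ)) {T : ℝ} (hT : 0 ≤ T) :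
    ∃ m : ℕ → ℝ → ℂ, (∀ j, ContinuousOn (m j) (Icc 0 T)) ∧
      (∀ α ∈ Icc 0 T, ∀ μ : ℂ, IsEigenvalue (Beam.A a b α ξ) μ ↔ ∃ j, m j α = μ) ∧
      ∀ R : ℝ, {j : ℕ | ∃ α ∈ Icc 0 T, ‖m j α‖ ≤ R}.Finite := by
  obtain ⟨N, hN⟩ := exists_forall_char_ne_zero ha hb ξ T
  set r : ℕ → ℝ := fun k => radius (N + k) ^ 4 with hr
  have hrk : ∀ k : ℕ, (k : ℝ) ≤ r k := by
    intro k
    refine le_trans ?_ (natCast_le_radius_pow (N + k))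
    push_cast
    linarith [Nat.cast_nonneg (α := ℝ) N]
  -- Inner radii. The value -1 makes the region for k = 0 the full disc, with no condition at w = 0.
  let L : ℕ → ℝ := fun k => Nat.casesOn k (-1) r
  have hL : ∀ k : ℕ, (k : ℝ) - 1 ≤ L k := by
    rintro (_ | k)
    · simp [L]
    · simpa [L] using hrk k
  let Ω : ℕ → Set ℂ := fun k => {μ | L k < ‖freq a b μ‖ ∧ ‖freq a b μ‖ < r k}
  let K : ℕ → Set ℂ := fun k => {μ | L k ≤ ‖freq a b μ‖ ∧ ‖freq a b μ‖ ≤ r k}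
  have hB : ∀ k, HasBranches (fun μ => charS (freq a b μ)) (charG a b ξ) (Ω k) (Icc 0 T) := by
    intro k
    refine hasBranches_Icc (z₁ := 0) (K := K k) (differentiable_charS_freq a b)
      (differentiable_charG a b ξ)
      (fun z hz => charG_ne_zero ha.ne' b hξ hz) ?_ ?_ ?_ ?_ ?_ hT ?_
    · rw [freq_zero, charS_zero]; exact one_ne_zero
    · simp [charG]
    · exact (isOpen_lt continuous_const (continuous_freq a b).norm).inter
        (isOpen_lt (continuous_freq a b).norm continuous_const)
    · exact (isCompact_freq_le ha hb (N + k)).inter_left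
        (isClosed_le continuous_const (continuous_freq a b).norm)
    · exact fun μ hμ => ⟨hμ.1.le, hμ.2.le⟩
    · intro α hα z hz h0
      refine ⟨lt_of_le_of_ne hz.1 ?_, lt_of_le_of_ne hz.2 (hN _ (Nat.le_add_right N k) α hα z h0)⟩
      rcases k with _ | k
      · exact fun h => absurd (norm_nonneg (freq a b z)) (by rw [← h]; simp [L])
      · exact (hN _ (Nat.le_add_right N k) α hα z h0).symm
  have hcover : ∀ α ∈ Icc 0 T, ∀ μ : ℂ, charS (freq a b μ) + α * charG a b ξ μ = 0 →
      ∃ k, μ ∈ Ω k := by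
    intro α hα μ h0
    have hex : ∃ k, ‖freq a b μ‖ < r k := by
      obtain ⟨k, hk⟩ := exists_nat_gt ‖freq a b μ‖
      exact ⟨k, hk.trans_le (hrk k)⟩
    classical
    refine ⟨Nat.find hex, ?_, Nat.find_spec hex⟩
    rcases hk : Nat.find hex with _ | k
    · change (-1 : ℝ) < _
      linarith [norm_nonneg (freq a b μ)]
    · have := Nat.find_min hex (m := k) (by omega)
      exact lt_of_le_of_ne (not_lt.1 this) (hN _ (Nat.le_add_right N k) α hα μ h0).symm
  choose G hGf hGc hGi using hB
  have h0T : (0 : ℝ) ∈ Icc 0 T := ⟨le_rfl, hT⟩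
  have : ∀ k, Finite (G k) := fun k => hGf k
  -- The family must be infinite to be indexed by ℕ bijectively: padding a finite list with
  -- repetitions would violate local finiteness. The distinct values μ_n^+ at α = 0 lie on distinct
  -- branches.
  have : Infinite (Σ k, G k) := by
    have hmem : ∀ n : ℕ, ∃ x : Σ k, G k, x.2.1 0 = muZero a b (n + 1) 1 := by
      intro n
      have h1 : charS (freq a b (muZero a b (n + 1) 1)) +
          ((0 : ℝ) : ℂ) * charG a b ξ (muZero a b (n + 1) 1) = 0 := by
        rw [Complex.ofReal_zero, zero_mul, add_zero]
        exact (charS_freq_eq_zero_iff ha.ne' b _).2 ⟨n + 1, Nat.le_add_left 1 n, 1, rfl⟩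
      obtain ⟨k, hk⟩ := hcover 0 h0T _ h1
      obtain ⟨γ, hγ, he⟩ := (hGi k 0 h0T _).1 ⟨hk, h1⟩
      exact ⟨⟨k, γ, hγ⟩, he⟩
    choose x hx using hmem
    refine Infinite.of_injective x fun n n' h => ?_
    have h1 : muZero a b (n + 1) 1 = muZero a b (n' + 1) 1 := by rw [← hx, ← hx, h]
    have h2 := (freq_eq_iff ha.ne' b (n + 1) _).2 ⟨1, rfl⟩
    rw [h1, (freq_eq_iff ha.ne' b (n' + 1) _).2 ⟨1, rfl⟩] at h2
    have h3 : (((n' + 1 : ℕ) : ℝ) * Real.pi) ^ 4 = (((n + 1 : ℕ) : ℝ) * Real.pi) ^ 4 := by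
      exact_mod_cast h2
    have h4 := (pow_left_inj₀ (by positivity) (by positivity) four_ne_zero).1 h3
    have h5 : ((n' + 1 : ℕ) : ℝ) = ((n + 1 : ℕ) : ℝ) := mul_right_cancel₀ Real.pi_ne_zero h4
    have h6 : n' + 1 = n + 1 := by exact_mod_cast h5
    omega
  obtain ⟨hden⟩ := nonempty_denumerable (Σ k, G k)
  let e : (Σ k, G k) ≃ ℕ := Denumerable.eqv _
  refine ⟨fun j => ((e.symm j).2 : ℝ → ℂ), fun j => hGc _ _ (e.symm j).2.2, ?_, ?_⟩
  · intro α hα μ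
    rw [isEigenvalue_iff_char ha.ne']
    constructor
    · intro h0
      obtain ⟨k, hk⟩ := hcover α hα μ h0
      obtain ⟨γ, hγ, he⟩ := (hGi k α hα μ).1 ⟨hk, h0⟩
      exact ⟨e ⟨k, γ, hγ⟩,
        (congrArg (fun x : Σ k, G k => x.2.1 α) (e.symm_apply_apply _)).trans he⟩
    · rintro ⟨j, hj⟩
      exact ((hGi _ α hα μ).2 ⟨_, (e.symm j).2.2, hj⟩).2
  · intro R
    obtain ⟨M, hM⟩ := exists_nat_gt ((b * R + R ^ 2) / a + 1)
    have hfin : (⋃ k ∈ Iic M, range fun γ : G k => e ⟨k, γ⟩).Finite :=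
      (finite_Iic M).biUnion fun k _ => finite_range _
    refine hfin.subset ?_
    rintro j ⟨α, hα, hj⟩
    have h1 := ((hGi _ α hα _).2 ⟨_, (e.symm j).2.2, rfl⟩).1
    have h2 : L (e.symm j).1 < (b * R + R ^ 2) / a := h1.1.trans_le (norm_freq_le ha hb hj)
    have h3 := hL (e.symm j).1
    have h4 : ((e.symm j).1 : ℝ) < M := by linarith
    refine mem_iUnion₂.2 ⟨(e.symm j).1, ?_, (e.symm j).2, ?_⟩
    · exact le_of_lt (by exact_mod_cast h4)
    · simp

/-! ### The limit of a branch as α → 0⁺ -/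

theorem lt_of_forall_ne {u : ℝ → ℝ} {d c : ℝ} (hu : ContinuousOn u (Ioo 0 d))
    (hne : ∀ x ∈ Ioo 0 d, u x ≠ c) {x₀ : ℝ} (hx₀ : x₀ ∈ Ioo 0 d) (h0 : u x₀ < c) :
    ∀ x ∈ Ioo 0 d, u x < c := by
  intro x hx
  by_contra! hcon
  obtain ⟨y, hy, hyc⟩ := isPreconnected_Ioo.intermediate_value hx₀ hx hu ⟨h0.le, hcon⟩
  exact hne y hy hyc

/-- A cluster point z exists by compactness and is a zero of f. On a small sphere around z, |f| has
a positive minimum, so for small parameters the path cannot cross that sphere. Being inside at some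
such parameter, it stays inside. -/
theorem exists_tendsto_zero_of_continuousOn {f : ℂ → ℂ} (hf : Continuous f)
    (hiso : ∀ z, f z = 0 → ∀ᶠ y in 𝓝[≠] z, f y ≠ 0) {μ : ℝ → ℂ} {d : ℝ} (hd : 0 < d)
    (hμ : ContinuousOn μ (Ioo 0 d)) {K : Set ℂ} (hK : IsCompact K) (hμK : ∀ x ∈ Ioo 0 d, μ x ∈ K)
    (hlim : Tendsto (fun x => f (μ x)) (𝓝[>] 0) (𝓝 0)) :
    ∃ z, f z = 0 ∧ Tendsto μ (𝓝[>] 0) (𝓝 z) := by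
  have hIoo : Ioo 0 d ∈ 𝓝[>] (0 : ℝ) := Ioo_mem_nhdsGT hd
  obtain ⟨z, -, hz⟩ := hK.exists_mapClusterPt (f := 𝓝[>] (0 : ℝ)) (u := μ)
    (tendsto_principal.2 (by filter_upwards [hIoo] with x hx using hμK x hx))
  have hfz : f z = 0 := by
    have h1 : MapClusterPt (f z) (𝓝[>] (0 : ℝ)) (f ∘ μ) := hz.continuousAt_comp hf.continuousAt
    have h2 : ClusterPt (f z) (𝓝 0) := h1.clusterPt.mono hlim
    exact eq_of_nhds_neBot h2
  refine ⟨z, hfz, Metric.tendsto_nhds.2 fun ε hε => ?_⟩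
  obtain ⟨η, hη, hηf⟩ := Metric.mem_nhdsWithin_iff.1 (hiso z hfz)
  set ε' := min ε (η / 2) with hε'
  have hε'0 : 0 < ε' := lt_min hε (half_pos hη)
  have hsphere : ∀ y ∈ Metric.sphere z ε', f y ≠ 0 := by
    intro y hy
    refine hηf ⟨?_, ?_⟩
    · rw [Metric.mem_ball, Metric.mem_sphere.1 hy]
      exact (min_le_right _ _).trans_lt (half_lt_self hη)
    · rintro rfl
      rw [Metric.mem_sphere, dist_self] at hy
      exact hε'0.ne hy
  obtain ⟨y₀, hy₀, hmin⟩ := (isCompact_sphere z ε').exists_isMinOn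
    ((NormedSpace.sphere_nonempty (E := ℂ)).2 hε'0.le) hf.norm.continuousOn
  have hc : 0 < ‖f y₀‖ := norm_pos_iff.2 (hsphere y₀ hy₀)
  have hev : ∀ᶠ x in 𝓝[>] (0 : ℝ), x ∈ Ioo 0 d ∧ ‖f (μ x)‖ < ‖f y₀‖ := by
    filter_upwards [hIoo, Metric.tendsto_nhds.1 hlim _ hc] with x h1 h2
    exact ⟨h1, by simpa using h2⟩
  obtain ⟨δ, hδ, hδs⟩ := mem_nhdsGT_iff_exists_Ioo_subset.1 hev
  have hδ0 : 0 < δ := hδ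
  have hδI : Ioo 0 δ ∈ 𝓝[>] (0 : ℝ) := Ioo_mem_nhdsGT hδ0
  obtain ⟨x₀, hx₀1, hx₀2⟩ := ((mapClusterPt_iff_frequently.1 hz (Metric.ball z ε')
    (Metric.ball_mem_nhds z hε'0)).and_eventually hδI).exists
  have hall := lt_of_forall_ne (u := fun x => dist (μ x) z) (d := δ) (c := ε')
    (((continuous_id.dist continuous_const).comp_continuousOn
      (hμ.mono fun x hx => (hδs hx).1)))
    (fun x hx h => absurd (hδs hx).2 (not_lt.2 (hmin (Metric.mem_sphere.2 h)))) hx₀2 hx₀1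
  filter_upwards [hδI] with x hx
  exact (hall x hx).trans_le (min_le_left _ _)

/-- The branch lies inside a large separating circle at one parameter, hence at all, since crossing
it is impossible. This gives the compact set and the bound on g needed for f(μ(α)) = -α g(μ(α)) → 0.
-/
theorem exists_tendsto_muZero {a b : ℝ} (ha : 0 < a) (hb : 0 ≤ b) (ξ : Ioo (0 : ℝ) 1)
    {d : ℝ} (hd : 0 < d) {μ : ℝ → ℂ} (hμ : ContinuousOn μ (Ioo 0 d))
    (hE : ∀ α ∈ Ioo 0 d, IsEigenvalue (Beam.A a b α ξ) (μ α)) :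
    ∃ n : ℕ, 1 ≤ n ∧ ∃ s : ℤˣ, Tendsto μ (𝓝[>] 0) (𝓝 (muZero a b n s)) := by
  obtain ⟨N, hN⟩ := exists_forall_char_ne_zero ha hb ξ d
  have hE' : ∀ α ∈ Ioo 0 d, charS (freq a b (μ α)) + α * charG a b ξ (μ α) = 0 :=
    fun α hα => (isEigenvalue_iff_char ha.ne' b α ξ _).1 (hE α hα)
  have hmid : d / 2 ∈ Ioo 0 d := ⟨half_pos hd, half_lt_self hd⟩
  obtain ⟨k, hk⟩ := exists_nat_gt ‖freq a b (μ (d / 2))‖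
  have hk' : ‖freq a b (μ (d / 2))‖ < radius (N + k) ^ 4 := by
    refine hk.trans_le (le_trans ?_ (natCast_le_radius_pow (N + k)))
    push_cast
    linarith [Nat.cast_nonneg (α := ℝ) N]
  have hK := isCompact_freq_le (b := b) ha hb (N + k)
  have hμK : ∀ α ∈ Ioo 0 d, ‖freq a b (μ α)‖ < radius (N + k) ^ 4 :=
    lt_of_forall_ne ((continuous_freq a b).norm.comp_continuousOn hμ)
      (fun α hα => hN _ (Nat.le_add_right N k) α (Ioo_subset_Icc_self hα) _ (hE' α hα)) hmid hk'
  have hlim : Tendsto (fun α => charS (freq a b (μ α))) (𝓝[>] 0) (𝓝 0) := by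
    obtain ⟨C, hC⟩ := hK.exists_bound_of_continuousOn
      (differentiable_charG a b ξ).continuous.continuousOn
    have h1 : Tendsto (fun α : ℝ => α * C) (𝓝[>] 0) (𝓝 0) := by
      have : Tendsto (fun α : ℝ => α * C) (𝓝 0) (𝓝 (0 * C)) :=
        tendsto_id.mul_const C
      rw [zero_mul] at this
      exact this.mono_left nhdsWithin_le_nhds
    refine squeeze_zero_norm' ?_ h1
    filter_upwards [Ioo_mem_nhdsGT hd] with α hα
    rw [eq_neg_of_add_eq_zero_left (hE' α hα), norm_neg, norm_mul, Complex.norm_real,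
      Real.norm_of_nonneg hα.1.le]
    exact mul_le_mul_of_nonneg_left (hC _ (hμK α hα).le) hα.1.le
  have hdiff := differentiable_charS_freq a b
  obtain ⟨z, hz, hlz⟩ := exists_tendsto_zero_of_continuousOn hdiff.continuous (fun z _ => by
    refine (hdiff.analyticAt z).eventually_eq_zero_or_eventually_ne_zero.resolve_left fun H => ?_
    have := AnalyticOnNhd.eq_of_eventuallyEq (f := fun y => charS (freq a b y)) (g := 0)
      (fun y _ => hdiff.analyticAt y) (fun y _ => analyticAt_const) H
    have h2 := congrFun this 0
    simp only [freq_zero, charS_zero, Pi.zero_apply] at h2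
    exact one_ne_zero h2) hd hμ hK (fun α hα => (hμK α hα).le) hlim
  obtain ⟨n, hn, s, rfl⟩ := (charS_freq_eq_zero_iff ha.ne' b z).1 hz
  exact ⟨n, hn, s, hlz⟩

/-! ### Convergence of the eigenvectors -/

/-- Near the positive number t⁴ the prescribed root is the principal power w^(1/4), which is
continuous there. -/
theorem IsPrincipalRoot.tendsto {a b : ℝ} {μ lam : ℝ → ℂ} {l : Filter ℝ} {t : ℝ} (ht : 0 < t)
    (hr : ∀ᶠ α in l, IsPrincipalRoot a b (μ α) (lam α))
    (hμ : Tendsto (fun α => freq a b (μ α)) l (𝓝 ((t : ℂ) ^ 4))) :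
    Tendsto lam l (𝓝 t) := by
  have hpi := Real.pi_pos
  have ht4 : (t : ℂ) ^ 4 ∈ Complex.slitPlane := by
    rw [← Complex.ofReal_pow]
    exact Complex.ofReal_mem_slitPlane.2 (pow_pos ht 4)
  have h1 := hμ.cpow (tendsto_const_nhds (x := ((4 : ℕ) : ℂ)⁻¹)) ht4
  rw [Complex.pow_cpow_nat_inv four_ne_zero] at h1
  · refine h1.congr' ?_
    filter_upwards [hr, hμ (Complex.isOpen_slitPlane.mem_nhds ht4)] with α h2 h3
    obtain ⟨h4, h5, h6⟩ := h2
    change freq a b (μ α) ∈ Complex.slitPlane at h3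
    rw [freq, ← h4] at h3
    rw [freq, ← h4, Complex.pow_cpow_nat_inv four_ne_zero]
    -- The principal power has arguments in (-π/4, π/4], the prescribed root in [-π/4, π/4). An
    -- argument -π/4 would make λ⁴ a nonpositive real, outside the slit plane.
    · refine lt_of_le_of_ne (by push_cast; exact h5) ?_
      intro h7
      have h8 : (lam α).arg = -(Real.pi / 4) := by rw [← h7]; norm_num
      have h9 : lam α ^ 4 = ((-‖lam α‖ ^ 4 : ℝ) : ℂ) := by
        conv_lhs => rw [← Complex.norm_mul_exp_arg_mul_I (lam α)]
        rw [mul_pow, ← Complex.exp_nat_mul, h8,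
          show ((4 : ℕ) : ℂ) * (((-(Real.pi / 4) : ℝ) : ℂ) * Complex.I) = -(Real.pi * Complex.I) by
            push_cast; ring, Complex.exp_neg, Complex.exp_pi_mul_I]
        push_cast
        norm_num
      rw [h9, Complex.ofReal_mem_slitPlane] at h3
      have := pow_nonneg (norm_nonneg (lam α)) 4
      linarith
    · push_cast
      exact h6.le
  · rw [Complex.arg_ofReal_of_nonneg ht.le]
    push_cast
    linarith
  · rw [Complex.arg_ofReal_of_nonneg ht.le]
    push_cast
    linarith

/-- Multiplication by i exchanges sin and sinh up to a factor i. Every term has three such factors,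
and i³ together with the sign from the exchange gives i. -/
theorem phi_I_mul (ξ : ℝ) (l : ℂ) (x : ℝ) :
    phi ξ (Complex.I * l) x = Complex.I * phi ξ l x := by
  have h1 : ∀ z : ℂ, Complex.sin (Complex.I * z) = Complex.I * Complex.sinh z := fun z => by
    rw [mul_comm, Complex.sin_mul_I, mul_comm]
  have h2 : ∀ z : ℂ, Complex.sinh (Complex.I * z) = Complex.I * Complex.sin z := fun z => by
    rw [mul_comm, Complex.sinh_mul_I, mul_comm]
  have h3 : ‖Complex.I * l‖ = ‖l‖ := by simp
  have h4 := Complex.I_sq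
  unfold phi
  rw [h3]
  simp only [mul_assoc Complex.I l, h1, h2]
  generalize (((1 / ‖l‖ ^ 2 * Real.exp ((ξ - 2) * ‖l‖) : ℝ) : ℂ)) = k
  generalize (if ξ ≤ x then (1 : ℂ) else 0) = c
  have h5 : Complex.I ^ 3 = -Complex.I := by rw [pow_succ, h4]; ring
  ring_nf
  simp only [h5]
  ring

theorem phi_mul {ζ : ℂ} (hζ : ζ ^ 4 = 1) (ξ : ℝ) (l : ℂ) (x : ℝ) :
    phi ξ (ζ * l) x = ζ * phi ξ l x := by
  have hI := Complex.I_sq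
  have hneg : ∀ l, phi ξ (-l) x = -phi ξ l x := by
    intro l
    have h : -l = Complex.I * (Complex.I * l) := by linear_combination -l * hI
    rw [h, phi_I_mul, phi_I_mul]
    linear_combination phi ξ l x * hI
  have h : (ζ ^ 2 - 1) * (ζ ^ 2 + 1) = 0 := by linear_combination hζ
  rcases mul_eq_zero.1 h with h | h
  · rcases sq_eq_one_iff.1 (sub_eq_zero.1 h) with rfl | rfl
    · rw [one_mul, one_mul]
    · rw [neg_one_mul, hneg, neg_one_mul]
  · have h' : ζ ^ 2 = Complex.I ^ 2 := by rw [hI]; linear_combination h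
    rcases sq_eq_sq_iff_eq_or_eq_neg.1 h' with rfl | rfl
    · exact phi_I_mul ξ l x
    · rw [neg_mul, hneg, phi_I_mul, neg_mul]

theorem continuousAt_phi (ξ x : ℝ) {l : ℂ} (hl : l ≠ 0) :
    ContinuousAt (fun l => phi ξ l x) l := by
  unfold phi
  refine ContinuousAt.mul (Complex.continuous_ofReal.continuousAt.comp ?_)
    (Continuous.continuousAt ?_)
  · have : ‖l‖ ^ 2 ≠ 0 := pow_ne_zero 2 (norm_ne_zero_iff.2 hl)
    exact (continuousAt_const.div (continuous_norm.pow 2).continuousAt this).mul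
      (Real.continuous_exp.comp (continuous_const.mul continuous_norm)).continuousAt
  · fun_prop

theorem phi_natCast_mul_pi (ξ : ℝ) (n : ℕ) (x : ℝ) :
    phi ξ (n * Real.pi) x = ((1 / ‖(n * Real.pi : ℂ)‖ ^ 2 *
      Real.exp ((ξ - 2) * ‖(n * Real.pi : ℂ)‖) : ℝ) : ℂ) * (Complex.sinh (n * Real.pi) *
      Complex.sin (n * Real.pi * (1 - ξ))) * Complex.sin (n * Real.pi * x) := by
  unfold phi
  rw [sin_nat_mul_pi_complex]
  ring

/-- The formula for φ is the profile with the coefficients of sin(λx) and sinh(λx) rewritten in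
fundamental solutions. It can only fail to be an eigenvector by vanishing, which the two
nonvanishing hypotheses exclude. -/
theorem isEigenfunction_Phi {a b α : ℝ} (ha : a ≠ 0) (ξ : Ioo (0 : ℝ) 1) {μ l ζ : ℂ}
    (hζ : ζ ^ 4 = 1) (hl4 : l ^ 4 = freq a b μ) (hl : l ≠ 0) (h1 : Complex.sinh l ≠ 0)
    (h2 : Complex.sin (l * (1 - (ξ : ℝ))) ≠ 0) (hE : IsEigenvalue (Beam.A a b α ξ) μ) :
    IsEigenfunction (Beam.A a b α ξ) μ (Phi ξ (ζ * l) μ) := by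
  have hw : (a : ℂ) * l ^ 4 = -(b * μ + μ ^ 2) := by rw [hl4, mul_freq ha]
  have hF := (isEigenvalue_iff ha ξ hw).1 hE
  have hζ0 : ζ ≠ 0 := by
    rintro rfl
    simp at hζ
  obtain ⟨k, hk⟩ : ∃ k : ℂ, k = ζ * ((1 / ‖l‖ ^ 2 * Real.exp (((ξ : ℝ) - 2) * ‖l‖) : ℝ) : ℂ) :=
    ⟨_, rfl⟩
  have hk0 : k ≠ 0 := by
    rw [hk]
    refine mul_ne_zero hζ0 (Complex.ofReal_ne_zero.2 ?_)
    have := norm_pos_iff.2 hl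
    positivity
  have hsinh := sinh_mul_eq_kry l 1
  have hsin := sin_mul_eq_kry l 1
  rw [mul_one] at hsinh hsin
  obtain ⟨P, hP⟩ : ∃ P : ℂ, P = k * (Complex.sinh l * Complex.sin (l * (1 - (ξ : ℝ)))) :=
    ⟨_, rfl⟩
  obtain ⟨Q, hQ⟩ : ∃ Q : ℂ, Q = -k * (Complex.sin l * Complex.sinh (l * (1 - (ξ : ℝ)))) :=
    ⟨_, rfl⟩
  have hP0 : P ≠ 0 := by rw [hP]; exact mul_ne_zero hk0 (mul_ne_zero h1 h2)
  -- P and Q are the coefficients of sin(λx) and sinh(λx), so A = λ(P + Q) and B = λ³(Q - P). C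
  -- comes from sinh - sin = 2λ³ `kry 3`.
  have key := isEigenfunction_profile (α := α) ξ (A := l * (P + Q)) (B := l ^ 3 * (Q - P))
    (C := 2 * l ^ 3 * (k * (Complex.sin l * Complex.sinh l))) hw ?_ ?_
  · convert! key using 2 with x
    have hphi : phi ξ (ζ * l) x = profile ξ (l ^ 4) (l * (P + Q)) (l ^ 3 * (Q - P))
        (2 * l ^ 3 * (k * (Complex.sin l * Complex.sinh l))) 0 x := by
      rw [phi_mul hζ, phi, ← mul_assoc, ← hk, hP, hQ]
      simp only [profile, jet, Complex.ofReal_sub]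
      rw [sinh_mul_eq_kry l x, sin_mul_eq_kry l x, sinh_mul_eq_kry l (x - (ξ : ℝ)),
        sin_mul_eq_kry l (x - (ξ : ℝ))]
      split_ifs <;> ring
    rw [Phi, hphi]
  · by_contra! h0
    have e1 := (mul_eq_zero.1 h0.1).resolve_left hl
    have e2 := (mul_eq_zero.1 h0.2).resolve_left (pow_ne_zero 3 hl)
    apply hP0
    linear_combination (e1 - e2) / 2
  · rw [sinh_mul_eq_kry, hsin] at hQ
    rw [sin_mul_eq_kry, hsinh] at hP
    rw [hsin, hsinh, hP, hQ]
    simp only [LoadEq, jet]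
    push_cast
    -- The conditions at x = 1 hold identically in λ by the shape of φ. Only the jump law uses the
    -- characteristic equation.
    refine ⟨by ring, by ring, ?_⟩
    rw [charS, charT] at hF
    push_cast at hF
    linear_combination 2 * l ^ 5 * k * hF

theorem isEigenfunction_PhiZero {a : ℝ} (ha : a ≠ 0) (b : ℝ) (ξ : Ioo (0 : ℝ) 1) {n : ℕ}
    (hn : 1 ≤ n) (s : ℤˣ) :
    IsEigenfunction (Beam.A a b 0 ξ) (muZero a b n s) (PhiZero a b n s) := by
  have hw := mul_freq ha b (muZero a b n s)
  rw [(freq_eq_iff ha b n _).2 ⟨s, rfl⟩] at hw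
  have hsin := sin_mul_eq_kry (n * Real.pi) 1
  rw [mul_one, sin_nat_mul_pi_complex] at hsin
  have hl : (n * Real.pi : ℂ) ≠ 0 := mul_ne_zero
    (Nat.cast_ne_zero.2 (Nat.one_le_iff_ne_zero.1 hn)) (Complex.ofReal_ne_zero.2 Real.pi_ne_zero)
  have key := isEigenfunction_profile (α := 0) ξ (A := n * Real.pi) (B := -(n * Real.pi) ^ 3)
    (C := 0) hw (Or.inl hl) ?_
  · convert! key using 2 with x
    have h : Complex.sin (n * Real.pi * x) = profile ξ ((n * Real.pi : ℂ) ^ 4) (n * Real.pi)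
        (-(n * Real.pi) ^ 3) 0 0 x := by
      rw [sin_mul_eq_kry]
      simp only [profile, jet, zero_mul, add_zero, ite_self]
      ring
    rw [PhiZero, h]
  · simp only [LoadEq, jet]
    push_cast
    refine ⟨?_, ?_, ?_⟩
    · linear_combination -hsin
    · linear_combination (n * Real.pi : ℂ) ^ 2 * hsin
    · ring

theorem tendsto_Phi {a b : ℝ} (ha : 0 < a) (ξ : Ioo (0 : ℝ) 1) (hξ : Irrational (ξ : ℝ))
    {n : ℕ} (hn : 1 ≤ n) (s : ℤˣ) {d : ℝ} (hd : 0 < d) {μ lam : ℝ → ℂ}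
    (hE : ∀ α ∈ Ioo 0 d, IsEigenvalue (Beam.A a b α ξ) (μ α))
    (hlam : ∀ α ∈ Ioo 0 d, IsPrincipalRoot a b (μ α) (lam α))
    (hμ : Tendsto μ (𝓝[>] 0) (𝓝 (muZero a b n s))) {ζ : ℂ} (hζ : ζ ^ 4 = 1) :
    (∀ᶠ α in 𝓝[>] 0, IsEigenfunction (Beam.A a b α ξ) (μ α) (Phi ξ (ζ * lam α) (μ α))) ∧
      ∃ c : ℂ, c ≠ 0 ∧ ∀ x ∈ Ioo (0 : ℝ) 1,
        Tendsto (fun α => Phi ξ (ζ * lam α) (μ α) x) (𝓝[>] 0)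
          (𝓝 (c • PhiZero a b n s x)) := by
  have hIoo : Ioo 0 d ∈ 𝓝[>] (0 : ℝ) := Ioo_mem_nhdsGT hd
  have hn0 : (0 : ℝ) < n * Real.pi := mul_pos (by exact_mod_cast hn) Real.pi_pos
  have hfr : Tendsto (fun α => freq a b (μ α)) (𝓝[>] 0) (𝓝 (((n * Real.pi : ℝ) : ℂ) ^ 4)) := by
    have := ((continuous_freq a b).tendsto _).comp hμ
    rw [(freq_eq_iff ha.ne' b n _).2 ⟨s, rfl⟩] at this
    push_cast
    exact this
  have hl : Tendsto lam (𝓝[>] 0) (𝓝 (n * Real.pi : ℂ)) := by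
    have := IsPrincipalRoot.tendsto hn0 (by filter_upwards [hIoo] with α hα using hlam α hα) hfr
    push_cast at this
    exact this
  have hl0 : (n * Real.pi : ℂ) ≠ 0 := by exact_mod_cast hn0.ne'
  have hsin : Complex.sin (n * Real.pi * (1 - (ξ : ℝ))) ≠ 0 := by
    have h1 : Irrational (1 - (ξ : ℝ)) := by simpa using hξ.ratCast_sub 1
    have h2 := sin_nat_mul_pi_mul_ne_zero h1 hn
    push_cast at h2
    exact h2
  have hsinh := sinh_nat_mul_pi_ne_zero hn
  have hζ0 : ζ ≠ 0 := by
    rintro rfl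
    simp at hζ
  constructor
  · have e1 := (Complex.continuous_sinh.tendsto _).comp hl |>.eventually_ne hsinh
    have e2 := ((Complex.continuous_sin.comp (continuous_id.mul
      (continuous_const (y := 1 - ((ξ : ℝ) : ℂ))))).tendsto _).comp hl |>.eventually_ne hsin
    filter_upwards [hIoo, e1, e2, hl.eventually_ne hl0] with α h1 h2 h3 h4
    exact isEigenfunction_Phi ha.ne' ξ hζ (hlam α h1).1 h4 h2 h3 (hE α h1)
  -- The constant is ζ times the coefficient of sin(nπx) that remains in φ at λ = nπ.
  · refine ⟨ζ * (((1 / ‖(n * Real.pi : ℂ)‖ ^ 2 *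
      Real.exp (((ξ : ℝ) - 2) * ‖(n * Real.pi : ℂ)‖) : ℝ) : ℂ) * (Complex.sinh (n * Real.pi) *
      Complex.sin (n * Real.pi * (1 - (ξ : ℝ))))), ?_, fun x _ => ?_⟩
    · refine mul_ne_zero hζ0 (mul_ne_zero (Complex.ofReal_ne_zero.2 ?_) (mul_ne_zero hsinh hsin))
      have := norm_pos_iff.2 hl0
      positivity
    · have hphi : Tendsto (fun α => phi ξ (ζ * lam α) x) (𝓝[>] 0)
          (𝓝 (ζ * phi ξ (n * Real.pi) x)) := by
        simp only [phi_mul hζ]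
        exact ((continuousAt_phi ξ x hl0).tendsto.comp hl).const_mul ζ
      have := hphi.prodMk_nhds (hμ.mul hphi)
      convert! this using 2
      rw [phi_natCast_mul_pi, PhiZero]
      simp only [Prod.smul_mk, smul_eq_mul, Prod.mk.injEq]
      constructor <;> ring

end Beam

end

theorem mainTheorem10 (a b : ℝ) (ha : 0 < a) (hb : 0 < b) (ξ : Ioo (0 : ℝ) 1)
    (hξ : Irrational (ξ : ℝ)) :
    -- The eigenvalues are continuous functions of `α`.
    (∃ m : ℕ → ℝ → ℂ,
      (∀ j, ContinuousOn (m j) {α : ℝ | 0 ≤ α ∧ α * b < 6}) ∧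
      (∀ α : ℝ, 0 ≤ α → α * b < 6 → ∀ μ : ℂ,
        Beam.IsEigenvalue (Beam.A a b α ξ) μ ↔ ∃ j, m j α = μ) ∧
      (∀ R : ℝ, {j : ℕ | ∃ α : ℝ, 0 ≤ α ∧ α * b < 6 ∧ ‖m j α‖ ≤ R}.Finite)) ∧
    -- Along every continuous branch of eigenvalues the eigenvectors converge as `α → 0⁺`.
    (∀ (α₁ : ℝ), 0 < α₁ → α₁ * b ≤ 6 → ∀ μ lam : ℝ → ℂ,
      ContinuousOn μ (Ioo 0 α₁) →
      (∀ α ∈ Ioo 0 α₁, Beam.IsEigenvalue (Beam.A a b α ξ) (μ α)) →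
      (∀ α ∈ Ioo 0 α₁, Beam.IsPrincipalRoot a b (μ α) (lam α)) →
      ∃ n : ℕ, 1 ≤ n ∧ ∃ s : ℤˣ,
        Beam.IsEigenfunction (Beam.A a b 0 ξ) (Beam.muZero a b n s) (Beam.PhiZero a b n s) ∧
        Tendsto μ (𝓝[>] 0) (𝓝 (Beam.muZero a b n s)) ∧
        ∀ ζ : ℂ, ζ ^ 4 = 1 →
          (∀ᶠ α in 𝓝[>] 0, Beam.IsEigenfunction (Beam.A a b α ξ) (μ α)
            (Beam.Phi ξ (ζ * lam α) (μ α))) ∧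
          ∃ c : ℂ, c ≠ 0 ∧ ∀ x ∈ Ioo (0 : ℝ) 1,
            Tendsto (fun α => Beam.Phi ξ (ζ * lam α) (μ α) x) (𝓝[>] 0)
              (𝓝 (c • Beam.PhiZero a b n s x))) := by
  constructor
  · have hsub : ∀ α : ℝ, 0 ≤ α → α * b < 6 → α ∈ Icc 0 (6 / b) := fun α h0 h1 =>
      ⟨h0, (le_div_iff₀ hb).2 h1.le⟩
    -- The branches are built on the compact interval [0, 6/b] and then restricted.
    obtain ⟨m, hm1, hm2, hm3⟩ := Beam.exists_branches ha hb.le ξ hξ (T := 6 / b) (by positivity)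
    refine ⟨m, fun j => (hm1 j).mono fun α hα => hsub α hα.1 hα.2,
      fun α h0 h1 => hm2 α (hsub α h0 h1), fun R => (hm3 R).subset ?_⟩
    rintro j ⟨α, h0, h1, h2⟩
    exact ⟨α, hsub α h0 h1, h2⟩
  · intro α₁ hα₁ _ μ lam hμ hE hlam
    obtain ⟨n, hn, s, hlim⟩ := Beam.exists_tendsto_muZero ha hb.le ξ hα₁ hμ hE
    exact ⟨n, hn, s, Beam.isEigenfunction_PhiZero ha.ne' b ξ hn s, hlim,
      fun ζ hζ => Beam.tendsto_Phi ha ξ hξ hn s hα₁ hE hlam hlim hζ⟩
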